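/- **Setting.** Let $d\in\{2,3\}$ and let $\Omega\subset\mathbb R^d$ be a bounded domain that is the interior of its closure (e.g. a polygonal/polyhedral domain with Lipschitz boundary); $\|\cdot\|_\Omega$ is the norm of $L^2(\Omega)$. Let $\alpha:\Omega\times[0,\infty)\to\mathbb R$ be $\mathcal C^1$ in its second variable, with constants $0<c_a\le C_a$ such that $$c_a\le \alpha(x,t^2)+2t^2D_2\alpha(x,t^2)\le C_a\qquad\forall x\in\Omega,\ t>0 .$$ For $u,v,w\in H^1_0(\Omega)$ put $a(w;u,v)=\int_\Omega\alpha(\cdot,|\nabla w|^2)\nabla u\cdot\nabla v$ and, for $f\in L^2(\Omega)$, $L(v)=\int_\Omega fv$; let $\langle Au,v\rangle=a(u;u,v)$. Let $\mathcal T_0$ be a conforming triangulation of $\Omega$ into $d$-simplices, each with an ordering $(x_0,\dots,x_d)$ of its vertices and a type $\gamma\in\{0,\dots,d-1\}$, such that $\alpha(\cdot,t)$ and $tD_2\alpha(\cdot,t)$ are Lipschitz with a constant $\Lambda$ in the interior of each $T\in\mathcal T_0$, uniformly in $t>0$. Let $\mathbb T$ be the set of all conforming triangulations of $\Omega$ obtained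 from $\mathcal T_0$ by finitely many bisections, where $(x_0,\dots,x_d)_\gamma$ is bisected into $(x_0,\tfrac{x_0+x_d}2,x_1,\dots,x_\gamma,x_{\gamma+1},\dots,x_{d-1})$ and $(x_d,\tfrac{x_0+x_d}2,x_1,\dots,x_\gamma,x_{d-1},\dots,x_{\gamma+1})$, both of type $\gamma+1$ mod $d$. Let $\kappa_{\mathbb T}=\sup_{\mathcal T\in\mathbb T}\sup_{T\in\mathcal T}\operatorname{diam}(T)/\rho_T$, with $\rho_T$ the radius of the largest ball contained in $T$. For $\mathcal T\in\mathbb T$ let $\mathbb V_{\mathcal T}=\{V\in H^1_0(\Omega): V|_T\in\mathbb P_1(T)\ \forall T\in\mathcal T\}$. For $V\in\mathbb V_{\mathcal T}$ let $R(V)|_T=-\nabla\cdot[\alpha(\cdot,|\nabla V|^2)\nabla V]-f$ on each $T\in\mathcal T$; on a side $S$ shared by $T_1,T_2\in\mathcal T$ let $$J(V)|_S=\tfrac12\sum_{i=1,2}(\alpha(\cdot,|\nabla V|^2)\nabla V)|_{T_i}\cdot\vec n_i ,$$ with $\vec n_i$ the outward unit normal of $T_i$ on $S$, and let $J(V)|_S=0$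 for $S\subset\partial\Omega$. With $H_T=|T|^{1/d}$, $\overline{R}$ the mean value on each element and $\overline{J}$ the mean value on each side, put $$\operatorname{osc}_{\mathcal T}^2(V)=\sum_{T\in\mathcal T}\big(H_T^2\|R(V)-\overline{R(V)}\|_T^2+H_T\|J(V)-\overline{J(V)}\|_{\partial T}^2\big),$$ $$g_{\mathcal T}(V,W;T)=H_T\|R(V)-R(W)\|_T+H_T^{1/2}\|J(V)-J(W)\|_{\partial T}.$$ **Statement.** There is a constant $C_E>1$, depending only on $d$, on the problem data $\Omega,\alpha,c_a,C_a,\Lambda$, and on $\mathcal T_0$ only through $\kappa_{\mathbb T}$, such that the following holds. 1. For all $\mathcal T\in\mathbb T$, $f\in L^2(\Omega)$ and $V,W\in\mathbb V_{\mathcal T}$: $\displaystyle\sum_{T\in\mathcal T}g_{\mathcal T}^2(V,W;T)\le C_E\|\nabla(V-W)\|_\Omega^2 .$ 2. (Cea's Lemma for the total error) There are constants $c_A,C_A>0$ with $$\langle Au-Av,u-v\rangle\ge c_A\|\nabla(u-v)\|_\Omega^2,\qquad |\langle Au-Av,w\rangle|\le C_A\|\nabla(u-v)\|_\Omega\|\nabla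 w\|_\Omega\qquad\forall u,v,w\in H^1_0(\Omega),$$ and for every such pair $c_A,C_A$ and every $f\in L^2(\Omega)$: if $u\in H^1_0(\Omega)$ satisfies $a(u;u,v)=L(v)$ for all $v\in H^1_0(\Omega)$, $\mathcal T\in\mathbb T$, and $U\in\mathbb V_{\mathcal T}$ satisfies $a(U;U,V)=L(V)$ for all $V\in\mathbb V_{\mathcal T}$, then $$\|\nabla(U-u)\|_\Omega^2+\operatorname{osc}_{\mathcal T}^2(U)\le\frac{2C_EC_A}{c_A}\inf_{V\in\mathbb V_{\mathcal T}}\big(\|\nabla(V-u)\|_\Omega^2+\operatorname{osc}_{\mathcal T}^2(V)\big).$$ -/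

import Mathlib

open Set Filter MeasureTheory
open scoped Topology ENNReal ContDiff RealInnerProductSpace

noncomputable section

namespace QuasilinearFEM

/-- The Euclidean space `ℝ^d`. -/
abbrev E (d : ℕ) : Type := EuclideanSpace ℝ (Fin d)

/-! ### The space `H¹₀(Ω)` -/

/-- Lebesgue measure on `Ω`. -/
abbrev vol {d : ℕ} (Ω : Set (E d)) : Measure (E d) := volume.restrict Ω

/-- Pairs `(v, G)` with `v ∈ L²(Ω)` and `G ∈ L²(Ω; ℝ^d)`. An element `v` of `H¹₀(Ω)` is the pair
`(v, ∇v)`, so `v.1` is the function and `v.2` its weak gradient. -/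
abbrev L2Pair {d : ℕ} (Ω : Set (E d)) : Type := Lp ℝ 2 (vol Ω) × Lp (E d) 2 (vol Ω)

/-- The pairs `(φ, ∇φ)` with `φ ∈ C_c^∞(Ω)`. -/
def testPairs {d : ℕ} (Ω : Set (E d)) : Set (L2Pair Ω) :=
  {v | ∃ φ : E d → ℝ, ContDiff ℝ ∞ φ ∧ HasCompactSupport φ ∧ tsupport φ ⊆ Ω ∧
    v.1 =ᵐ[vol Ω] φ ∧ v.2 =ᵐ[vol Ω] gradient φ}

/-- `H¹₀(Ω)`: the closure of `C_c^∞(Ω)` in the graph norm of the gradient. -/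
def H10 {d : ℕ} (Ω : Set (E d)) : Submodule ℝ (L2Pair Ω) :=
  (Submodule.span ℝ (testPairs Ω)).topologicalClosure

/-! ### The quasi-linear problem -/

/-- The coefficient is `C¹` on `[0, ∞)` in its second variable and
`c_a ≤ α(x, t²) + 2 t² D₂α(x, t²) ≤ C_a` for `x ∈ Ω`, `t > 0`. -/
def IsAdmissibleCoeff {d : ℕ} (Ω : Set (E d)) (α : E d → ℝ → ℝ) (ca Ca : ℝ) : Prop :=
  (∀ x ∈ Ω, ContDiffOn ℝ 1 (α x) (Ici 0)) ∧
  ∀ x ∈ Ω, ∀ t : ℝ, 0 < t →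
    ca ≤ α x (t ^ 2) + 2 * t ^ 2 * deriv (α x) (t ^ 2) ∧
    α x (t ^ 2) + 2 * t ^ 2 * deriv (α x) (t ^ 2) ≤ Ca

/-- `a(w; u, v) = ∫_Ω α(·, |∇w|²) ∇u · ∇v`. -/
def form {d : ℕ} (Ω : Set (E d)) (α : E d → ℝ → ℝ) (w u v : L2Pair Ω) : ℝ :=
  ∫ x in Ω, α x (‖w.2 x‖ ^ 2) * ⟪u.2 x, v.2 x⟫

/-- `L(v) = ∫_Ω f v`. -/
def load {d : ℕ} (Ω : Set (E d)) (f : Lp ℝ 2 (vol Ω)) (v : L2Pair Ω) : ℝ :=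
  ∫ x in Ω, f x * v.1 x

/-- `u ∈ H¹₀(Ω)` is a weak solution: `a(u; u, v) = L(v)` for all `v ∈ H¹₀(Ω)`. -/
def IsWeakSolution {d : ℕ} (Ω : Set (E d)) (α : E d → ℝ → ℝ) (f : Lp ℝ 2 (vol Ω))
    (u : L2Pair Ω) : Prop :=
  u ∈ H10 Ω ∧ ∀ v ∈ H10 Ω, form Ω α u u v = load Ω f v

/-- `C_A` is a Lipschitz constant of `A u = a(u; u, ·)`, that is
`‖A u - A v‖_{H⁻¹} ≤ C_A ‖∇(u - v)‖` with the dual norm of `‖∇·‖`. -/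
def IsLipschitzConst {d : ℕ} (Ω : Set (E d)) (α : E d → ℝ → ℝ) (CA : ℝ) : Prop :=
  ∀ u ∈ H10 Ω, ∀ v ∈ H10 Ω, ∀ w ∈ H10 Ω,
    |form Ω α u u w - form Ω α v v w| ≤ CA * ‖(u - v).2‖ * ‖w.2‖

/-- `c_A` is a constant of strong monotonicity of `A`:
`⟨A u - A v, u - v⟩ ≥ c_A ‖∇(u - v)‖²`. -/
def IsMonotoneConst {d : ℕ} (Ω : Set (E d)) (α : E d → ℝ → ℝ) (cA : ℝ) : Prop :=
  ∀ u ∈ H10 Ω, ∀ v ∈ H10 Ω,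
    cA * ‖(u - v).2‖ ^ 2 ≤ form Ω α u u (u - v) - form Ω α v v (u - v)

/-! ### Triangulations and bisection -/

/-- A `d`-simplex in `ℝ^d` with ordered vertices and a type in `{0, …, d - 1}`, as used by the
bisection rule. -/
structure TaggedSimplex (d : ℕ) where
  /-- the simplex with its ordered vertices -/
  simplex : Affine.Simplex ℝ (E d) d
  /-- the type -/
  tag : Fin d

namespace TaggedSimplex

variable {d : ℕ}

/-- The vertex number `k` (for `k ≤ d`). -/
def vertex (T : TaggedSimplex d) (k : ℕ) : E d := T.simplex.points (Fin.ofNat (d + 1) k)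

/-- The closed simplex as a set. -/
def carrier (T : TaggedSimplex d) : Set (E d) := convexHull ℝ (range T.simplex.points)

/-- The side opposite to the vertex number `i`. -/
def side (T : TaggedSimplex d) (i : Fin (d + 1)) : Set (E d) :=
  convexHull ℝ (T.simplex.points '' {i}ᶜ)

/-- The outward unit normal on the side opposite to the vertex number `i`: it points from this
vertex to the foot of the altitude. -/
def normal [NeZero d] (T : TaggedSimplex d) (i : Fin (d + 1)) : E d :=
  ‖T.simplex.altitudeFoot i - T.simplex.points i‖⁻¹ •
    (T.simplex.altitudeFoot i - T.simplex.points i)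

/-- The local mesh size `H_T = |T|^{1/d}`. -/
def meshSize (T : TaggedSimplex d) : ℝ := (volume.real T.carrier) ^ (1 / (d : ℝ))

/-- The radius `ρ_T` of the largest ball contained in `T`. -/
def inradius (T : TaggedSimplex d) : ℝ :=
  sSup {r : ℝ | 0 ≤ r ∧ ∃ c : E d, Metric.closedBall c r ⊆ T.carrier}

/-- `T₁` and `T₂` are the two children of `T = (x₀, …, x_d)_γ` under bisection:
`T₁ = (x₀, (x₀ + x_d)/2, x₁, …, x_γ, x_{γ+1}, …, x_{d-1})` and
`T₂ = (x_d, (x₀ + x_d)/2, x₁, …, x_γ, x_{d-1}, …, x_{γ+1})`, both of type `γ + 1` modulo `d`. -/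
def IsBisection [NeZero d] (T T₁ T₂ : TaggedSimplex d) : Prop :=
  T₁.tag = T.tag + 1 ∧ T₂.tag = T.tag + 1 ∧
  (∀ i : Fin (d + 1), T₁.simplex.points i =
    if (i : ℕ) = 0 then T.vertex 0
    else if (i : ℕ) = 1 then midpoint ℝ (T.vertex 0) (T.vertex d)
    else T.vertex (i - 1)) ∧
  (∀ i : Fin (d + 1), T₂.simplex.points i =
    if (i : ℕ) = 0 then T.vertex d
    else if (i : ℕ) = 1 then midpoint ℝ (T.vertex 0) (T.vertex d)
    else if (i : ℕ) ≤ T.tag + 1 then T.vertex (i - 1)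
    else T.vertex (d + T.tag + 1 - i))

end TaggedSimplex

/-- A mesh: a finite set of simplices. -/
abbrev Mesh (d : ℕ) : Type := Finset (TaggedSimplex d)

/-- `𝒯` is a conforming triangulation of `Ω`: the elements cover `closure Ω`, do not overlap, and
two different elements meet in the (possibly empty) face spanned by their common vertices. -/
def IsConformingTriangulation {d : ℕ} (Ω : Set (E d)) (𝒯 : Mesh d) : Prop :=
  (⋃ T ∈ 𝒯, T.carrier) = closure Ω ∧
  ∀ T ∈ 𝒯, ∀ T' ∈ 𝒯, T ≠ T' →
    Disjoint (interior T.carrier) (interior T'.carrier) ∧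
    T.carrier ∩ T'.carrier =
      convexHull ℝ (range T.simplex.points ∩ range T'.simplex.points)

/-- `𝒯'` arises from `𝒯` by replacing one element by its two children. -/
def BisectStep {d : ℕ} [NeZero d] (𝒯 𝒯' : Mesh d) : Prop :=
  ∃ T ∈ 𝒯, ∃ T₁ T₂ : TaggedSimplex d, T.IsBisection T₁ T₂ ∧
    ∀ K : TaggedSimplex d, K ∈ 𝒯' ↔ (K ∈ 𝒯 ∧ K ≠ T) ∨ K = T₁ ∨ K = T₂

/-- The family `𝕋` of all conforming triangulations of `Ω` obtained from the initial mesh `𝒯₀` by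
finitely many bisections. -/
def meshFamily {d : ℕ} [NeZero d] (Ω : Set (E d)) (𝒯₀ : Mesh d) : Set (Mesh d) :=
  {𝒯 | Relation.ReflTransGen BisectStep 𝒯₀ 𝒯 ∧ IsConformingTriangulation Ω 𝒯}

/-- The shape regularity constant `κ_𝕋 = sup_{𝒯 ∈ 𝕋} sup_{T ∈ 𝒯} diam(T) / ρ_T`. -/
def shapeConst {d : ℕ} [NeZero d] (Ω : Set (E d)) (𝒯₀ : Mesh d) : ℝ≥0∞ :=
  ⨆ 𝒯 ∈ meshFamily Ω 𝒯₀, ⨆ T ∈ 𝒯, ENNReal.ofReal (Metric.diam T.carrier / T.inradius)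

/-- `α(·, t)` and `t D₂α(·, t)` are Lipschitz on each element of `𝒯₀`, with constant `Λ`, uniformly
in `t > 0`. The interior of the element is used, so that `α` may jump across the sides. -/
def IsPiecewiseLipschitz {d : ℕ} (𝒯₀ : Mesh d) (α : E d → ℝ → ℝ) (Λ : ℝ) : Prop :=
  ∀ T ∈ 𝒯₀, ∀ x ∈ interior T.carrier, ∀ y ∈ interior T.carrier, ∀ t : ℝ, 0 < t →
    |α x t - α y t| ≤ Λ * ‖x - y‖ ∧
    |t * deriv (α x) t - t * deriv (α y) t| ≤ Λ * ‖x - y‖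

/-! ### The discrete problem -/

/-- `𝕍_𝒯 = {V ∈ H¹₀(Ω) | V|_T ∈ ℙ₁(T) for all T ∈ 𝒯}`. -/
def feSpace {d : ℕ} (Ω : Set (E d)) (𝒯 : Mesh d) : Set (L2Pair Ω) :=
  {V | V ∈ H10 Ω ∧ ∀ T ∈ 𝒯, ∃ (p : E d) (b : ℝ),
    ∀ᵐ x ∂(vol Ω), x ∈ T.carrier → V.1 x = ⟪p, x⟫ + b}

/-- `U ∈ 𝕍_𝒯` solves the discrete problem: `a(U; U, V) = L(V)` for all `V ∈ 𝕍_𝒯`. -/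
def IsDiscreteSolution {d : ℕ} (Ω : Set (E d)) (α : E d → ℝ → ℝ) (f : Lp ℝ 2 (vol Ω))
    (𝒯 : Mesh d) (U : L2Pair Ω) : Prop :=
  U ∈ feSpace Ω 𝒯 ∧ ∀ V ∈ feSpace Ω 𝒯, form Ω α U U V = load Ω f V

/-! ### Residuals and oscillation -/

section Residuals

variable {d : ℕ} (Ω : Set (E d)) (α : E d → ℝ → ℝ) (f : Lp ℝ 2 (vol Ω)) (𝒯 : Mesh d)

/-- The value of `∇V` on `T` for `V ∈ 𝕍_𝒯`; as `∇V` is constant there, it is its mean value. -/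
def elemGrad (V : L2Pair Ω) (T : TaggedSimplex d) : E d := ⨍ x in interior T.carrier, V.2 x

/-- The divergence of a vector field (defined almost everywhere for a Lipschitz field). -/
def divergence (F : E d → E d) (x : E d) : ℝ :=
  ∑ i : Fin d, (fderiv ℝ F x (EuclideanSpace.single i 1)) i

/-- The element residual `R_𝒯(V)|_T = -∇ · [α(·, |∇V|²) ∇V] - f`. -/
def elemResidual (V : L2Pair Ω) (T : TaggedSimplex d) (x : E d) : ℝ :=
  -divergence (fun y => α y (‖elemGrad Ω V T‖ ^ 2) • elemGrad Ω V T) x - f x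

/-- The trace at `x ∈ ∂T` of the flux `α(·, |∇V|²) ∇V`, taken from inside `T`. -/
def fluxTrace (V : L2Pair Ω) (T : TaggedSimplex d) (x : E d) : E d :=
  limUnder (𝓝[interior T.carrier] x) (fun y => α y (‖elemGrad Ω V T‖ ^ 2)) • elemGrad Ω V T

open Classical in
/-- The jump residual `J_𝒯(V)` on the side `S`: zero if `S` lies on `∂Ω`, and otherwise one half of
the sum of the normal fluxes over the elements of `𝒯` that have `S` as a side. -/
def jumpResidual [NeZero d] (V : L2Pair Ω) (S : Set (E d)) (x : E d) : ℝ :=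
  if S ⊆ frontier Ω then 0
  else (1 / 2) * ∑ T ∈ 𝒯, ∑ i : Fin (d + 1),
    if T.side i = S then ⟪fluxTrace Ω α V T x, T.normal i⟫ else 0

/-- `osc_𝒯²(V; T) = H_T² ‖R - R̄‖²_T + H_T ‖J - J̄‖²_{∂T}`, where `R̄` is the mean value of `R` on
`T`, and `J̄` is on each side the mean value of `J` on that side. -/
def localOscSq [NeZero d] (V : L2Pair Ω) (T : TaggedSimplex d) : ℝ :=
  T.meshSize ^ 2 *
      (∫ x in T.carrier, (elemResidual Ω α f V T x -
        ⨍ y in T.carrier, elemResidual Ω α f V T y) ^ 2) +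
  T.meshSize * ∑ i : Fin (d + 1),
      ∫ x in T.side i, (jumpResidual Ω α 𝒯 V (T.side i) x -
        ⨍ y in T.side i, jumpResidual Ω α 𝒯 V (T.side i) y ∂μHE[d - 1]) ^ 2 ∂μHE[d - 1]

/-- The global oscillation `osc_𝒯²(V) = ∑_{T ∈ 𝒯} osc_𝒯²(V; T)`. -/
def oscSq [NeZero d] (V : L2Pair Ω) : ℝ := ∑ T ∈ 𝒯, localOscSq Ω α f 𝒯 V T

/-- `g_𝒯(V, W; T) = H_T ‖R(V) - R(W)‖_T + H_T^{1/2} ‖J(V) - J(W)‖_{∂T}`. -/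
def residualDiff [NeZero d] (V W : L2Pair Ω) (T : TaggedSimplex d) : ℝ :=
  T.meshSize * √(∫ x in T.carrier, (elemResidual Ω α f V T x - elemResidual Ω α f W T x) ^ 2) +
  √T.meshSize * √(∑ i : Fin (d + 1), ∫ x in T.side i,
    (jumpResidual Ω α 𝒯 V (T.side i) x - jumpResidual Ω α 𝒯 W (T.side i) x) ^ 2 ∂μHE[d - 1])

/-- The squared total error `‖∇(V - u)‖_Ω² + osc_𝒯²(V)`. -/
def totalErrorSq [NeZero d] (u V : L2Pair Ω) : ℝ := ‖(V - u).2‖ ^ 2 + oscSq Ω α f 𝒯 V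

end Residuals

end QuasilinearFEM

end

open QuasilinearFEM

/-! The flux `p ↦ α(x, |p|²) p` is radial, and the expression bounded by `ca` and `Ca` is the
derivative of its profile `t ↦ α(x, t²) t`. One-variable mean value estimates therefore make the
flux strongly monotone and Lipschitz in `p` (`IsAdmissibleCoeff.le_inner_flux_sub`,
`IsAdmissibleCoeff.norm_flux_sub_le`). The difference of the fluxes at `x` and `y` is radial too,
with profile derivative at most `3Λ|x - y|`; hence `x ↦ flux(x, p) - flux(x, q)` has Lipschitz
constant `3Λ|p - q|` inside an element (`norm_flux_sub_flux_le`).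

Discrete gradients are constant on elements. So `R(V) - R(W)`, in which `f` cancels, is a divergence
bounded by `3dΛ|∇(V - W)|`, and the jump difference is bounded by `Ca` times the gradient
differences on the elements at the side. Shape regularity bounds the number of these elements and
gives `H_T |S| ≲ |T'|` for all `T, T'` having `S` as a side. Summation yields part 1
(`sum_residualDiff_sq_le`).

For part 2, Galerkin orthogonality gives `‖∇(U - u)‖ ≤ (Ca/ca) ‖∇(V - u)‖`, and subtracting mean
values does not increase an `L²` norm, so `osc²(U) ≤ 2 osc²(V) + 2 ∑ g²`. The resulting factor
depends on `ca`, `Ca` and the constant `K` of part 1 only, and it is taken as `C_E`. For any other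
admissible pair the factor `2 C_A / c_A` is at least `1`, since `c_A ≤ C_A`.

The constant uses the real value of `κ_𝕋`, so `κ_𝕋 < ∞` is needed: bisection produces only finitely
many shapes up to homothety (`shapeConst_lt_top`). -/

noncomputable section

namespace QuasilinearFEM

/-! ### Radial vector fields -/

section Radial

variable {F : Type*} [NormedAddCommGroup F] [InnerProductSpace ℝ F]

/-- The square splits into a radial and an angular part, `|ap - bq|² = (a|p| - b|q|)² + 2ab(|p||q| -
⟪p, q⟫)`, and `a = b = 1` gives `|p - q|²`. The parts are compared separately; the angular factor is
nonnegative by Cauchy-Schwarz. -/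
theorem norm_smul_sub_smul_le {a b L : ℝ} (p q : F) (hL : 0 ≤ L)
    (hab : |a * ‖p‖ - b * ‖q‖| ≤ L * |‖p‖ - ‖q‖|)
    (ha : |a * ‖p‖| ≤ L * ‖p‖) (hb : |b * ‖q‖| ≤ L * ‖q‖) :
    ‖a • p - b • q‖ ≤ L * ‖p - q‖ := by
  have hc := real_inner_le_norm p q
  have h1 : (a * ‖p‖ - b * ‖q‖) ^ 2 ≤ L ^ 2 * (‖p‖ - ‖q‖) ^ 2 := by
    rw [← sq_abs, ← sq_abs (‖p‖ - ‖q‖), ← mul_pow]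
    gcongr
  have h2 : a * b * (‖p‖ * ‖q‖ - ⟪p, q⟫) ≤ L ^ 2 * (‖p‖ * ‖q‖ - ⟪p, q⟫) := by
    rcases eq_or_ne p 0 with rfl | hp
    · simp
    rcases eq_or_ne q 0 with rfl | hq
    · simp
    have hp' : 0 < ‖p‖ := norm_pos_iff.2 hp
    have hq' : 0 < ‖q‖ := norm_pos_iff.2 hq
    have ha' : |a| ≤ L := by
      rw [abs_mul, abs_of_pos hp'] at ha
      exact le_of_mul_le_mul_right ha hp'
    have hb' : |b| ≤ L := by
      rw [abs_mul, abs_of_pos hq'] at hb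
      exact le_of_mul_le_mul_right hb hq'
    refine mul_le_mul_of_nonneg_right ?_ (sub_nonneg.2 hc)
    calc a * b ≤ |a * b| := le_abs_self _
      _ = |a| * |b| := abs_mul _ _
      _ ≤ L * L := mul_le_mul ha' hb' (abs_nonneg _) hL
      _ = L ^ 2 := (sq L).symm
  have e1 : ‖a • p - b • q‖ ^ 2 = (a * ‖p‖ - b * ‖q‖) ^ 2 + 2 * (a * b * (‖p‖ * ‖q‖ - ⟪p, q⟫)) := by
    rw [norm_sub_sq_real, real_inner_smul_left, real_inner_smul_right, norm_smul, norm_smul,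
      mul_pow, mul_pow, Real.norm_eq_abs, Real.norm_eq_abs, sq_abs, sq_abs]
    ring
  have e2 : ‖p - q‖ ^ 2 = (‖p‖ - ‖q‖) ^ 2 + 2 * (‖p‖ * ‖q‖ - ⟪p, q⟫) := by
    rw [norm_sub_sq_real]
    ring
  refine le_of_sq_le_sq ?_ (by positivity)
  rw [mul_pow, e1, e2]
  linarith

/-- Again radial plus angular: the inner product equals `(a|p| - b|q|)(|p| - |q|) + (a + b)(|p||q| -
⟪p, q⟫)`. -/
theorem le_inner_smul_sub_smul {a b c : ℝ} (p q : F)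
    (hab : c * (‖p‖ - ‖q‖) ^ 2 ≤ (a * ‖p‖ - b * ‖q‖) * (‖p‖ - ‖q‖))
    (ha : c ≤ a) (hb : c ≤ b) :
    c * ‖p - q‖ ^ 2 ≤ ⟪a • p - b • q, p - q⟫ := by
  have hc := real_inner_le_norm p q
  have e1 : ⟪a • p - b • q, p - q⟫ = a * ‖p‖ ^ 2 + b * ‖q‖ ^ 2 - (a + b) * ⟪p, q⟫ := by
    rw [inner_sub_left, inner_sub_right, inner_sub_right, real_inner_smul_left,
      real_inner_smul_left, real_inner_smul_left, real_inner_smul_left, real_inner_self_eq_norm_sq,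
      real_inner_self_eq_norm_sq, real_inner_comm p q]
    ring
  rw [e1, norm_sub_sq_real]
  nlinarith [mul_nonneg (add_nonneg (sub_nonneg.2 ha) (sub_nonneg.2 hb)) (sub_nonneg.2 hc)]

end Radial

/-! ### Pointwise bounds for the coefficient -/

section Coefficient

/-- This identifies the quantity controlled by the admissibility condition as a derivative. Only `t
> 0` is available; continuity on the closed half-line takes care of the end point in the mean value
estimates. -/
theorem hasDerivAt_profile {β : ℝ → ℝ} (hβ : ContDiffOn ℝ 1 β (Ici 0)) {t : ℝ} (ht : 0 < t) :
    HasDerivAt (fun s => β (s ^ 2) * s) (β (t ^ 2) + 2 * t ^ 2 * deriv β (t ^ 2)) t := by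
  have h2 : 0 < t ^ 2 := by positivity
  have hd : DifferentiableAt ℝ β (t ^ 2) :=
    (hβ.differentiableOn (by norm_num)).differentiableAt (Ici_mem_nhds h2)
  have h3 : HasDerivAt (fun s => β (s ^ 2)) _ t :=
    HasDerivAt.comp t (h₂ := β) (h := fun s : ℝ => s ^ 2) hd.hasDerivAt (hasDerivAt_pow 2 t)
  refine (h3.mul (hasDerivAt_id t)).congr_deriv ?_
  simp
  ring

theorem continuousOn_profile {β : ℝ → ℝ} (hβ : ContDiffOn ℝ 1 β (Ici 0)) :
    ContinuousOn (fun s => β (s ^ 2) * s) (Ici 0) :=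
  (hβ.continuousOn.comp (by fun_prop) fun s _ => mem_Ici.2 (sq_nonneg s)).mul continuousOn_id

theorem profile_sub_le {β : ℝ → ℝ} (hβ : ContDiffOn ℝ 1 β (Ici 0)) {C : ℝ}
    (hC : ∀ t, 0 < t → β (t ^ 2) + 2 * t ^ 2 * deriv β (t ^ 2) ≤ C) {s t : ℝ} (hs : 0 ≤ s)
    (hst : s ≤ t) : β (t ^ 2) * t - β (s ^ 2) * s ≤ C * (t - s) := by
  refine (convex_Ici (0 : ℝ)).image_sub_le_mul_sub_of_deriv_le (f := fun s => β (s ^ 2) * s)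
    (continuousOn_profile hβ) ?_ ?_ s hs t (hs.trans hst) hst <;> rw [interior_Ici]
  · exact fun x hx => (hasDerivAt_profile hβ hx).differentiableAt.differentiableWithinAt
  · intro x hx
    rw [(hasDerivAt_profile hβ hx).deriv]
    exact hC x hx

theorem le_profile_sub {β : ℝ → ℝ} (hβ : ContDiffOn ℝ 1 β (Ici 0)) {C : ℝ}
    (hC : ∀ t, 0 < t → C ≤ β (t ^ 2) + 2 * t ^ 2 * deriv β (t ^ 2)) {s t : ℝ} (hs : 0 ≤ s)
    (hst : s ≤ t) : C * (t - s) ≤ β (t ^ 2) * t - β (s ^ 2) * s := by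
  refine (convex_Ici (0 : ℝ)).mul_sub_le_image_sub_of_le_deriv (f := fun s => β (s ^ 2) * s)
    (continuousOn_profile hβ) ?_ ?_ s hs t (hs.trans hst) hst <;> rw [interior_Ici]
  · exact fun x hx => (hasDerivAt_profile hβ hx).differentiableAt.differentiableWithinAt
  · intro x hx
    rw [(hasDerivAt_profile hβ hx).deriv]
    exact hC x hx

theorem abs_profile_sub_le {β : ℝ → ℝ} (hβ : ContDiffOn ℝ 1 β (Ici 0)) {C : ℝ}
    (hC : ∀ t, 0 < t → |β (t ^ 2) + 2 * t ^ 2 * deriv β (t ^ 2)| ≤ C) {s t : ℝ} (hs : 0 ≤ s)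
    (ht : 0 ≤ t) : |β (t ^ 2) * t - β (s ^ 2) * s| ≤ C * |t - s| := by
  wlog hst : s ≤ t generalizing s t
  · rw [abs_sub_comm, abs_sub_comm t]
    exact this ht hs (le_of_not_ge hst)
  rw [abs_of_nonneg (sub_nonneg.2 hst), abs_le]
  have h1 := profile_sub_le hβ (fun t ht => (abs_le.1 (hC t ht)).2) hs hst
  have h2 := le_profile_sub hβ (fun t ht => (abs_le.1 (hC t ht)).1) hs hst
  constructor <;> linarith

/-- No sign of `β` is assumed, so that the bound also applies to the difference of two coefficients.
-/
theorem norm_radial_sub_le {F : Type*} [NormedAddCommGroup F] [InnerProductSpace ℝ F]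
    {β : ℝ → ℝ} (hβ : ContDiffOn ℝ 1 β (Ici 0)) {C : ℝ}
    (hC : ∀ t, 0 < t → |β (t ^ 2) + 2 * t ^ 2 * deriv β (t ^ 2)| ≤ C) (p q : F) :
    ‖β (‖p‖ ^ 2) • p - β (‖q‖ ^ 2) • q‖ ≤ C * ‖p - q‖ := by
  have hb : ∀ p : F, |β (‖p‖ ^ 2) * ‖p‖| ≤ C * ‖p‖ := fun p => by
    simpa using abs_profile_sub_le hβ hC le_rfl (norm_nonneg p)
  exact norm_smul_sub_smul_le p q ((abs_nonneg _).trans (hC 1 one_pos))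
    (abs_profile_sub_le hβ hC (norm_nonneg q) (norm_nonneg p)) (hb p) (hb q)

variable {d : ℕ} {Ω : Set (E d)} {α : E d → ℝ → ℝ} {ca Ca : ℝ}

theorem IsAdmissibleCoeff.le_Ca (hα : IsAdmissibleCoeff Ω α ca Ca) {x : E d} (hx : x ∈ Ω) :
    ca ≤ Ca :=
  (hα.2 x hx 1 one_pos).1.trans (hα.2 x hx 1 one_pos).2

theorem IsAdmissibleCoeff.bounds (hα : IsAdmissibleCoeff Ω α ca Ca) {x : E d} (hx : x ∈ Ω)
    {t : ℝ} (ht : 0 ≤ t) : ca ≤ α x t ∧ α x t ≤ Ca := by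
  have hpos : ∀ s : ℝ, 0 < s → ca ≤ α x s ∧ α x s ≤ Ca := by
    intro s hs
    have hs' := Real.sqrt_pos.2 hs
    have h1 := profile_sub_le (hα.1 x hx) (fun t ht => (hα.2 x hx t ht).2) le_rfl hs'.le
    have h2 := le_profile_sub (hα.1 x hx) (fun t ht => (hα.2 x hx t ht).1) le_rfl hs'.le
    simp only [Real.sq_sqrt hs.le, mul_zero, sub_zero] at h1 h2
    exact ⟨le_of_mul_le_mul_right h2 hs', le_of_mul_le_mul_right h1 hs'⟩
  rcases ht.eq_or_lt with rfl | ht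
  · have hc : Tendsto (α x) (𝓝[>] 0) (𝓝 (α x 0)) :=
      ((hα.1 x hx).continuousOn 0 self_mem_Ici).mono_left (nhdsWithin_mono _ Ioi_subset_Ici_self)
    exact ⟨ge_of_tendsto hc (eventually_mem_nhdsWithin.mono fun s hs => (hpos s hs).1),
      le_of_tendsto hc (eventually_mem_nhdsWithin.mono fun s hs => (hpos s hs).2)⟩
  · exact hpos t ht

theorem IsAdmissibleCoeff.norm_flux_sub_le (hα : IsAdmissibleCoeff Ω α ca Ca) (hca : 0 < ca)
    {x : E d} (hx : x ∈ Ω) (p q : E d) :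
    ‖α x (‖p‖ ^ 2) • p - α x (‖q‖ ^ 2) • q‖ ≤ Ca * ‖p - q‖ :=
  norm_radial_sub_le (hα.1 x hx) (fun t ht => by
    have := hα.2 x hx t ht
    exact abs_le.2 ⟨by linarith [hα.le_Ca hx], this.2⟩) p q

theorem IsAdmissibleCoeff.le_inner_flux_sub (hα : IsAdmissibleCoeff Ω α ca Ca)
    {x : E d} (hx : x ∈ Ω) (p q : E d) :
    ca * ‖p - q‖ ^ 2 ≤ ⟪α x (‖p‖ ^ 2) • p - α x (‖q‖ ^ 2) • q, p - q⟫ := by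
  refine le_inner_smul_sub_smul p q ?_ (hα.bounds hx (sq_nonneg _)).1
    (hα.bounds hx (sq_nonneg _)).1
  have key : ∀ s t : ℝ, 0 ≤ s → s ≤ t →
      ca * (t - s) ^ 2 ≤ (α x (t ^ 2) * t - α x (s ^ 2) * s) * (t - s) := fun s t hs hst => by
    have := le_profile_sub (hα.1 x hx) (fun t ht => (hα.2 x hx t ht).1) hs hst
    nlinarith [sub_nonneg.2 hst]
  rcases le_total ‖q‖ ‖p‖ with h | h
  · exact key _ _ (norm_nonneg q) h
  · have := key _ _ (norm_nonneg p) h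
    linarith

/-- The difference `α x - α y` is itself a radial coefficient. Its profile derivative at `t`
combines the two Lipschitz hypotheses at `t²` with weights `1` and `2`, whence the factor `3`. -/
theorem norm_flux_sub_flux_le (hα : IsAdmissibleCoeff Ω α ca Ca) {S : Set (E d)} (hS : S ⊆ Ω)
    {Λ : ℝ} {x y : E d} (hx : x ∈ S) (hy : y ∈ S)
    (hΛ : ∀ t : ℝ, 0 < t → |α x t - α y t| ≤ Λ * ‖x - y‖ ∧
      |t * deriv (α x) t - t * deriv (α y) t| ≤ Λ * ‖x - y‖) (p q : E d) :
    ‖(α x (‖p‖ ^ 2) • p - α x (‖q‖ ^ 2) • q) - (α y (‖p‖ ^ 2) • p - α y (‖q‖ ^ 2) • q)‖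
      ≤ 3 * Λ * ‖p - q‖ * ‖x - y‖ := by
  have hβ : ContDiffOn ℝ 1 (fun t => α x t - α y t) (Ici 0) :=
    (hα.1 x (hS hx)).sub (hα.1 y (hS hy))
  have := norm_radial_sub_le hβ (C := 3 * Λ * ‖x - y‖) (fun t ht => by
    have h2 : 0 < t ^ 2 := by positivity
    have hd : ∀ z ∈ S, DifferentiableAt ℝ (α z) (t ^ 2) := fun z hz =>
      ((hα.1 z (hS hz)).differentiableOn (by norm_num)).differentiableAt (Ici_mem_nhds h2)
    have e : deriv (fun t => α x t - α y t) (t ^ 2) = deriv (α x) (t ^ 2) - deriv (α y) (t ^ 2) :=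
      deriv_sub (hd x hx) (hd y hy)
    rw [e]
    obtain ⟨h3, h4⟩ := hΛ _ h2
    rw [abs_le] at h3 h4 ⊢
    constructor <;> linarith) p q
  calc _ = ‖(α x (‖p‖ ^ 2) - α y (‖p‖ ^ 2)) • p - (α x (‖q‖ ^ 2) - α y (‖q‖ ^ 2)) • q‖ := by
        congr 1
        module
    _ ≤ _ := this
    _ = _ := by ring

end Coefficient

/-! ### Elements of a conforming triangulation -/

section Elements

variable {d : ℕ} {Ω : Set (E d)} {𝒯 : Mesh d}

theorem TaggedSimplex.convex_carrier (T : TaggedSimplex d) : Convex ℝ T.carrier :=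
  convex_convexHull ℝ _

theorem TaggedSimplex.isCompact_carrier (T : TaggedSimplex d) : IsCompact T.carrier :=
  (finite_range _).isCompact_convexHull ℝ

theorem TaggedSimplex.volume_frontier (T : TaggedSimplex d) : volume (frontier T.carrier) = 0 :=
  T.convex_carrier.addHaar_frontier volume

theorem TaggedSimplex.restrict_interior (T : TaggedSimplex d) :
    (volume : Measure (E d)).restrict (interior T.carrier) = volume.restrict T.carrier :=
  Measure.restrict_congr_set (interior_ae_eq_of_null_frontier T.volume_frontier)

theorem TaggedSimplex.volume_carrier_lt_top (T : TaggedSimplex d) : volume T.carrier < ⊤ :=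
  T.isCompact_carrier.measure_lt_top

theorem IsConformingTriangulation.carrier_subset (h𝒯 : IsConformingTriangulation Ω 𝒯)
    {T : TaggedSimplex d} (hT : T ∈ 𝒯) : T.carrier ⊆ closure Ω :=
  h𝒯.1 ▸ subset_biUnion_of_mem (u := fun T : TaggedSimplex d => T.carrier) hT

theorem IsConformingTriangulation.interior_subset (h𝒯 : IsConformingTriangulation Ω 𝒯)
    (hΩ : interior (closure Ω) = Ω) {T : TaggedSimplex d} (hT : T ∈ 𝒯) :
    interior T.carrier ⊆ Ω :=
  hΩ ▸ interior_mono (h𝒯.carrier_subset hT)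

theorem IsConformingTriangulation.ae_mem_interior (h𝒯 : IsConformingTriangulation Ω 𝒯) :
    ∀ᵐ x ∂(volume : Measure (E d)), x ∈ Ω → ∃ T ∈ 𝒯, x ∈ interior T.carrier := by
  have h1 : ∀ᵐ x ∂(volume : Measure (E d)), ∀ T ∈ 𝒯, x ∉ frontier T.carrier := by
    rw [Filter.eventually_all_finset]
    exact fun T _ => measure_eq_zero_iff_ae_notMem.1 T.volume_frontier
  filter_upwards [h1] with x hx hxΩ
  obtain ⟨T, hT, hxT⟩ := mem_iUnion₂.1 (h𝒯.1.symm ▸ subset_closure hxΩ : x ∈ ⋃ T ∈ 𝒯, T.carrier)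
  refine ⟨T, hT, ?_⟩
  by_contra hn
  exact hx T hT ⟨subset_closure hxT, hn⟩

end Elements

/-! ### The flux as a map of `L²(Ω; ℝ^d)` -/

section Flux

variable {d : ℕ} {Ω : Set (E d)} {α : E d → ℝ → ℝ} {ca Ca Λ : ℝ} {𝒯 : Mesh d}

theorem IsPiecewiseLipschitz.abs_sub_le (hΛ : IsPiecewiseLipschitz 𝒯 α Λ)
    (hα : IsAdmissibleCoeff Ω α ca Ca) {T : TaggedSimplex d} (hT : T ∈ 𝒯)
    (hTΩ : interior T.carrier ⊆ Ω) {x y : E d} (hx : x ∈ interior T.carrier)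
    (hy : y ∈ interior T.carrier) {t : ℝ} (ht : 0 ≤ t) : |α x t - α y t| ≤ Λ * ‖x - y‖ := by
  rcases ht.eq_or_lt with rfl | ht
  · have hc : ∀ z ∈ interior T.carrier, Tendsto (α z) (𝓝[>] 0) (𝓝 (α z 0)) := fun z hz =>
      ((hα.1 z (hTΩ hz)).continuousOn 0 self_mem_Ici).mono_left
        (nhdsWithin_mono _ Ioi_subset_Ici_self)
    exact le_of_tendsto ((hc x hx).sub (hc y hy)).abs
      (eventually_mem_nhdsWithin.mono fun s hs => (hΛ T hT x hx y hy s hs).1)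
  · exact (hΛ T hT x hx y hy t ht).1

/-- The Lipschitz bound in `x` is uniform in `t`, so separate continuity upgrades to joint
continuity. This is the source of measurability for `x ↦ α x (‖G x‖ ^ 2)`. -/
theorem continuousOn_coeff (hΛ : IsPiecewiseLipschitz 𝒯 α Λ)
    (hα : IsAdmissibleCoeff Ω α ca Ca) {T : TaggedSimplex d} (hT : T ∈ 𝒯)
    (hTΩ : interior T.carrier ⊆ Ω) :
    ContinuousOn (Function.uncurry α) (interior T.carrier ×ˢ Ici 0) := by
  rintro ⟨x, t⟩ ⟨hx, ht⟩
  have h1 : Tendsto (fun z : E d × ℝ => α x z.2) (𝓝[interior T.carrier ×ˢ Ici 0] (x, t))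
      (𝓝 (α x t)) := by
    refine ((hα.1 x (hTΩ hx)).continuousOn t ht).tendsto.comp ?_
    refine tendsto_nhdsWithin_iff.2 ⟨(continuous_snd.tendsto (x, t)).mono_left inf_le_left, ?_⟩
    exact eventually_mem_nhdsWithin.mono fun z hz => hz.2
  have h2 : Tendsto (fun z : E d × ℝ => α z.1 z.2 - α x z.2)
      (𝓝[interior T.carrier ×ˢ Ici 0] (x, t)) (𝓝 0) := by
    refine squeeze_zero_norm' (a := fun z : E d × ℝ => Λ * ‖z.1 - x‖) ?_ ?_
    · exact eventually_mem_nhdsWithin.mono fun z hz => hΛ.abs_sub_le hα hT hTΩ hz.1 hx hz.2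
    · have : Continuous fun z : E d × ℝ => Λ * ‖z.1 - x‖ := by fun_prop
      simpa using (this.tendsto (x, t)).mono_left nhdsWithin_le_nhds
  have := h2.add h1
  simpa [ContinuousWithinAt, Function.uncurry_def] using this

theorem aestronglyMeasurable_coeff (h𝒯 : IsConformingTriangulation Ω 𝒯)
    (hΩ : interior (closure Ω) = Ω) (hΛ : IsPiecewiseLipschitz 𝒯 α Λ)
    (hα : IsAdmissibleCoeff Ω α ca Ca) {G : E d → E d} (hG : AEStronglyMeasurable G (vol Ω)) :
    AEStronglyMeasurable (fun x => α x (‖G x‖ ^ 2)) (vol Ω) := by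
  have hT : ∀ T : 𝒯, AEStronglyMeasurable (fun x => α x (‖G x‖ ^ 2))
      (volume.restrict (interior T.1.carrier)) := by
    rintro ⟨T, hT⟩
    have hTΩ := h𝒯.interior_subset hΩ hT
    have hG' := hG.mono_measure (Measure.restrict_mono hTΩ le_rfl)
    classical
    have hm : Measurable ((interior T.carrier ×ˢ Ici (0 : ℝ)).piecewise (Function.uncurry α) 0) :=
      (continuousOn_coeff hΛ hα hT hTΩ).measurable_piecewise continuousOn_const
        (isOpen_interior.measurableSet.prod measurableSet_Ici)
    have h1 : Measurable fun x => (x, ‖hG'.mk G x‖ ^ 2) :=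
      measurable_id.prodMk (hG'.stronglyMeasurable_mk.measurable.norm.pow_const 2)
    refine (hm.comp h1).aestronglyMeasurable.congr ?_
    filter_upwards [hG'.ae_eq_mk, ae_restrict_mem isOpen_interior.measurableSet] with x hx hxT
    have : (x, ‖hG'.mk G x‖ ^ 2) ∈ interior T.carrier ×ˢ Ici (0 : ℝ) := ⟨hxT, mem_Ici.2 (sq_nonneg _)⟩
    simp only [Function.comp_apply, piecewise_eq_of_mem _ _ _ this, Function.uncurry_apply_pair, hx]
  have h1 := (aestronglyMeasurable_iUnion_iff (μ := (volume : Measure (E d)))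
    (s := fun T : 𝒯 => interior T.1.carrier)).2 hT
  refine h1.mono_measure (Measure.restrict_mono_ae ?_)
  filter_upwards [h𝒯.ae_mem_interior] with x hx hxΩ
  obtain ⟨T, hT, hxT⟩ := hx hxΩ
  exact mem_iUnion.2 ⟨⟨T, hT⟩, hxT⟩

/-- Writing the form as an `L²` inner product with a nonlinear map turns the pointwise flux bounds
into Hilbert space inequalities. -/
theorem exists_fluxMap (h𝒯 : IsConformingTriangulation Ω 𝒯) (hΩo : IsOpen Ω)
    (hΩ : interior (closure Ω) = Ω) (hΛ : IsPiecewiseLipschitz 𝒯 α Λ)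
    (hα : IsAdmissibleCoeff Ω α ca Ca) (hca : 0 < ca) :
    ∃ A : Lp (E d) 2 (vol Ω) → Lp (E d) 2 (vol Ω),
      (∀ u v : L2Pair Ω, form Ω α u u v = ⟪A u.2, v.2⟫) ∧
      (∀ p q, ‖A p - A q‖ ≤ Ca * ‖p - q‖) ∧
      (∀ p q, ca * ‖p - q‖ ^ 2 ≤ ⟪A p - A q, p - q⟫) := by
  have hmem : ∀ᵐ x ∂(vol Ω), x ∈ Ω := ae_restrict_mem hΩo.measurableSet
  have hM : ∀ p : Lp (E d) 2 (vol Ω), MemLp (fun x => α x (‖p x‖ ^ 2) • p x) 2 (vol Ω) := by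
    intro p
    refine MemLp.of_le_mul (c := Ca) (Lp.memLp p)
      ((aestronglyMeasurable_coeff h𝒯 hΩ hΛ hα (Lp.aestronglyMeasurable p)).smul
        (Lp.aestronglyMeasurable p)) ?_
    filter_upwards [hmem] with x hx
    -- Comparison with the zero vector turns the Lipschitz bound into linear growth.
    simpa using hα.norm_flux_sub_le hca hx (p x) 0
  have hA := fun p => (hM p).coeFn_toLp
  refine ⟨fun p => (hM p).toLp _, fun u v => ?_, fun p q => ?_, fun p q => ?_⟩
  · rw [L2.inner_def]
    refine integral_congr_ae ?_
    filter_upwards [hA u.2] with x hx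
    rw [hx, real_inner_smul_left]
  · refine Lp.norm_le_mul_norm_of_ae_le_mul ?_
    filter_upwards [hmem, hA p, hA q, Lp.coeFn_sub p q, Lp.coeFn_sub ((hM p).toLp _) ((hM q).toLp _)]
      with x hx h1 h2 h3 h4
    rw [h3, h4, Pi.sub_apply, Pi.sub_apply, h1, h2]
    exact hα.norm_flux_sub_le hca hx _ _
  · rw [← real_inner_self_eq_norm_sq, L2.inner_def, L2.inner_def, ← integral_const_mul]
    refine integral_mono_ae ((L2.integrable_inner _ _).const_mul _) (L2.integrable_inner _ _) ?_
    filter_upwards [hmem, hA p, hA q, Lp.coeFn_sub p q, Lp.coeFn_sub ((hM p).toLp _) ((hM q).toLp _)]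
      with x hx h1 h2 h3 h4
    rw [h3, h4, Pi.sub_apply, Pi.sub_apply, h1, h2, real_inner_self_eq_norm_sq]
    exact hα.le_inner_flux_sub hx _ _

end Flux

/-! ### Monotonicity, Lipschitz continuity and the Galerkin estimate -/

section Galerkin

variable {d : ℕ} {Ω : Set (E d)} {α : E d → ℝ → ℝ} {ca Ca : ℝ}
  {A : Lp (E d) 2 (vol Ω) → Lp (E d) 2 (vol Ω)}

theorem isMonotoneConst_of_fluxMap (hA : ∀ u v : L2Pair Ω, form Ω α u u v = ⟪A u.2, v.2⟫)
    (hm : ∀ p q, ca * ‖p - q‖ ^ 2 ≤ ⟪A p - A q, p - q⟫) : IsMonotoneConst Ω α ca := by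
  intro u _ v _
  rw [hA, hA, ← inner_sub_left]
  exact hm u.2 v.2

theorem isLipschitzConst_of_fluxMap (hA : ∀ u v : L2Pair Ω, form Ω α u u v = ⟪A u.2, v.2⟫)
    (hl : ∀ p q, ‖A p - A q‖ ≤ Ca * ‖p - q‖) : IsLipschitzConst Ω α Ca := by
  intro u _ v _ w _
  rw [hA, hA, ← inner_sub_left]
  exact (abs_real_inner_le_norm _ _).trans (mul_le_mul_of_nonneg_right (hl u.2 v.2) (norm_nonneg _))

theorem sub_mem_feSpace {𝒯 : Mesh d} {V W : L2Pair Ω} (hV : V ∈ feSpace Ω 𝒯)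
    (hW : W ∈ feSpace Ω 𝒯) : V - W ∈ feSpace Ω 𝒯 := by
  refine ⟨Submodule.sub_mem _ hV.1 hW.1, fun T hT => ?_⟩
  obtain ⟨p, b, hp⟩ := hV.2 T hT
  obtain ⟨q, c, hq⟩ := hW.2 T hT
  refine ⟨p - q, b - c, ?_⟩
  filter_upwards [hp, hq, Lp.coeFn_sub V.1 W.1] with x h1 h2 h3 hx
  rw [Prod.fst_sub, h3, Pi.sub_apply, h1 hx, h2 hx, inner_sub_left]
  ring

/-- Since `V - U` is discrete, the residual `A u - A U` is orthogonal to it, and `U` may be replaced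
by `V` in one slot of the monotonicity inequality. -/
theorem galerkin_estimate (hA : ∀ u v : L2Pair Ω, form Ω α u u v = ⟪A u.2, v.2⟫)
    (hl : ∀ p q, ‖A p - A q‖ ≤ Ca * ‖p - q‖)
    (hm : ∀ p q, ca * ‖p - q‖ ^ 2 ≤ ⟪A p - A q, p - q⟫) {f : Lp ℝ 2 (vol Ω)} {𝒯 : Mesh d}
    (hca : 0 < ca) {u U V : L2Pair Ω} (hu : IsWeakSolution Ω α f u)
    (hU : IsDiscreteSolution Ω α f 𝒯 U) (hV : V ∈ feSpace Ω 𝒯) :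
    ‖(U - u).2‖ ≤ Ca / ca * ‖(V - u).2‖ := by
  have hUV := sub_mem_feSpace hV hU.1
  have h0 : ⟪A u.2 - A U.2, (V - U).2⟫ = 0 := by
    rw [inner_sub_left, ← hA, ← hA, hu.2 _ hUV.1, hU.2 _ hUV, sub_self]
  have h1 := hm u.2 U.2
  have h2 : ⟪A u.2 - A U.2, u.2 - U.2⟫ = ⟪A u.2 - A U.2, u.2 - V.2⟫ := by
    rw [← add_zero ⟪A u.2 - A U.2, u.2 - V.2⟫, ← h0, ← inner_add_right, Prod.snd_sub]
    congr 1
    abel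
  have h3 : ⟪A u.2 - A U.2, u.2 - V.2⟫ ≤ Ca * ‖u.2 - U.2‖ * ‖u.2 - V.2‖ :=
    (real_inner_le_norm _ _).trans (mul_le_mul_of_nonneg_right (hl _ _) (norm_nonneg _))
  rw [Prod.snd_sub, Prod.snd_sub, norm_sub_rev, norm_sub_rev V.2, div_mul_eq_mul_div,
    le_div_iff₀ hca]
  -- A factor `‖u.2 - U.2‖` has to be cancelled. If it vanishes, only nonnegativity of the
  -- right-hand side remains.
  rcases (norm_nonneg (u.2 - U.2)).eq_or_lt with h | h
  · rw [← h, zero_mul]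
    have := (norm_nonneg _).trans (hl (u.2) V.2)
    exact this
  · nlinarith

end Galerkin

/-! ### Weak gradients -/

section WeakGradient

variable {d : ℕ} {Ω : Set (E d)}

theorem contDiff_gradient_continuous {φ : E d → ℝ} (hφ : ContDiff ℝ ∞ φ) :
    Continuous (gradient φ) :=
  (InnerProductSpace.toDual ℝ (E d)).symm.continuous.comp (hφ.continuous_fderiv (by simp))

theorem hasCompactSupport_gradient {φ : E d → ℝ} (hφ : HasCompactSupport φ) :
    HasCompactSupport (gradient φ) :=
  (hφ.fderiv ℝ).comp_left (map_zero _)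

/-- For fixed `φ` and `e` the identity says that a continuous linear functional vanishes at `v`. It
vanishes on test pairs by integration by parts, hence on their closure. The support of `φ` need not
lie in `Ω`, because the test functions vanish near the boundary. -/
theorem integral_inner_snd_mul {v : L2Pair Ω} (hv : v ∈ H10 Ω) {φ : E d → ℝ}
    (hφ : ContDiff ℝ ∞ φ) (hφc : HasCompactSupport φ) (e : E d) :
    ∫ x in Ω, φ x * ⟪v.2 x, e⟫ = -∫ x in Ω, v.1 x * fderiv ℝ φ x e := by
  have hdc : Continuous fun x => fderiv ℝ φ x e :=
    (hφ.continuous_fderiv (by simp)).clm_apply continuous_const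
  have h1 : MemLp (fun x => fderiv ℝ φ x e) 2 (vol Ω) :=
    (hdc.memLp_of_hasCompactSupport (hφc.fderiv_apply ℝ e)).restrict Ω
  have h2 : MemLp (fun x => φ x • e) 2 (vol Ω) :=
    ((hφ.continuous.smul continuous_const).memLp_of_hasCompactSupport hφc.smul_right).restrict Ω
  have e1 : ∀ v : L2Pair Ω, ⟪h1.toLp _, v.1⟫ = ∫ x in Ω, v.1 x * fderiv ℝ φ x e := fun v => by
    rw [L2.inner_def]
    refine integral_congr_ae ?_
    filter_upwards [h1.coeFn_toLp] with x hx
    rw [hx]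
    simp
  have e2 : ∀ v : L2Pair Ω, ⟪h2.toLp _, v.2⟫ = ∫ x in Ω, φ x * ⟪v.2 x, e⟫ := fun v => by
    rw [L2.inner_def]
    refine integral_congr_ae ?_
    filter_upwards [h2.coeFn_toLp] with x hx
    rw [hx, real_inner_smul_left, real_inner_comm]
  let Φ : L2Pair Ω →L[ℝ] ℝ := (innerSL ℝ (h2.toLp _)).comp (ContinuousLinearMap.snd ℝ _ _) +
    (innerSL ℝ (h1.toLp _)).comp (ContinuousLinearMap.fst ℝ _ _)
  have hΦ : H10 Ω ≤ LinearMap.ker (Φ : L2Pair Ω →ₗ[ℝ] ℝ) := by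
    refine Submodule.topologicalClosure_minimal _ (Submodule.span_le.2 ?_) Φ.isClosed_ker
    rintro w ⟨ψ, hψ, hψc, hψΩ, hw1, hw2⟩
    have : ⟪h2.toLp _, w.2⟫ + ⟪h1.toLp _, w.1⟫ = (0 : ℝ) := by
      rw [e1, e2]
      have i1 : ∫ x in Ω, φ x * ⟪w.2 x, e⟫ = ∫ x, fderiv ℝ ψ x e * φ x := by
        refine Eq.trans ?_ (setIntegral_eq_integral_of_forall_compl_eq_zero (s := Ω) ?_)
        · refine integral_congr_ae ?_
          filter_upwards [hw2] with x hx
          rw [hx, inner_gradient_left, mul_comm]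
        · intro x hx
          rw [fderiv_of_notMem_tsupport ℝ fun h => hx (hψΩ h)]
          simp
      have i2 : ∫ x in Ω, w.1 x * fderiv ℝ φ x e = ∫ x, ψ x * fderiv ℝ φ x e := by
        refine Eq.trans ?_ (setIntegral_eq_integral_of_forall_compl_eq_zero (s := Ω) ?_)
        · refine integral_congr_ae ?_
          filter_upwards [hw1] with x hx
          rw [hx]
        · intro x hx
          rw [image_eq_zero_of_notMem_tsupport fun h => hx (hψΩ h), zero_mul]
      have hdψ : Continuous fun x => fderiv ℝ ψ x e :=
        (hψ.continuous_fderiv (by simp)).clm_apply continuous_const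
      rw [i1, i2, integral_mul_fderiv_eq_neg_fderiv_mul_of_integrable
        ((hdψ.mul hφ.continuous).integrable_of_hasCompactSupport hφc.mul_left)
        ((hψ.continuous.mul hdc).integrable_of_hasCompactSupport hψc.mul_right)
        ((hψ.continuous.mul hφ.continuous).integrable_of_hasCompactSupport hψc.mul_right)
        (fun x _ => hψ.differentiable (by simp) x) (fun x _ => hφ.differentiable (by simp) x),
        add_neg_cancel]
    exact this
  have h3 : ⟪h2.toLp _, v.2⟫ + ⟪h1.toLp _, v.1⟫ = (0 : ℝ) := hΦ hv
  rw [e1, e2] at h3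
  exact eq_neg_of_add_eq_zero_left h3

/-- The discrete space constrains only the function component. Comparing its weak gradient with that
of the affine function, tested on bumps supported in `O`, recovers the gradient component. -/
theorem ae_snd_eq_of_ae_fst_eq {v : L2Pair Ω} (hv : v ∈ H10 Ω) {O : Set (E d)} (hO : IsOpen O)
    (hOΩ : O ⊆ Ω) {p : E d} {b : ℝ} (hp : ∀ᵐ x ∂(vol Ω), x ∈ O → v.1 x = ⟪p, x⟫ + b) :
    ∀ᵐ x ∂(vol Ω), x ∈ O → v.2 x = p := by
  have key : ∀ e : E d, ∀ᵐ x ∂(vol Ω), x ∈ O → ⟪v.2 x - p, e⟫ = 0 := by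
    intro e
    have hloc : LocallyIntegrable (fun x => ⟪v.2 x, e⟫) (vol Ω) :=
      ((Lp.memLp v.2).inner_const e).locallyIntegrable (by norm_num)
    have hloc' : LocallyIntegrable (fun x => ⟪v.2 x - p, e⟫) (vol Ω) := by
      simp only [inner_sub_left]
      exact hloc.sub (continuous_const.locallyIntegrable)
    refine hO.ae_eq_zero_of_integral_contDiff_smul_eq_zero (hloc'.locallyIntegrableOn O) ?_
    intro φ hφ hφc hφO
    have hdφ : Continuous fun x => fderiv ℝ φ x e :=
      (hφ.continuous_fderiv (by simp)).clm_apply continuous_const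
    have hg : Differentiable ℝ fun x : E d => ⟪p, x⟫ + b :=
      ((differentiable_const p).inner ℝ differentiable_id).add_const b
    have hgd : ∀ x, fderiv ℝ (fun x : E d => ⟪p, x⟫ + b) x e = ⟪p, e⟫ := fun x => by
      rw [fderiv_add_const, fderiv_inner_apply ℝ (by fun_prop) (by fun_prop)]
      simp
    have i1 : ∫ x in Ω, v.1 x * fderiv ℝ φ x e = ∫ x, (⟪p, x⟫ + b) * fderiv ℝ φ x e := by
      refine Eq.trans ?_ (setIntegral_eq_integral_of_forall_compl_eq_zero (s := Ω) ?_)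
      · refine integral_congr_ae ?_
        filter_upwards [hp] with x hx
        by_cases hxO : x ∈ O
        · rw [hx hxO]
        · rw [fderiv_of_notMem_tsupport ℝ fun h => hxO (hφO h)]
          simp
      · intro x hx
        rw [fderiv_of_notMem_tsupport ℝ fun h => hx (hOΩ (hφO h))]
        simp
    have i2 : ∫ x in Ω, φ x * ⟪p, e⟫ = ∫ x, ⟪p, e⟫ * φ x := by
      rw [setIntegral_eq_integral_of_forall_compl_eq_zero]
      · simp only [mul_comm]
      · intro x hx
        rw [image_eq_zero_of_notMem_tsupport fun h => hx (hOΩ (hφO h)), zero_mul]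
    have i3 := integral_mul_fderiv_eq_neg_fderiv_mul_of_integrable (μ := volume) (v := e)
      (f := fun x : E d => ⟪p, x⟫ + b) (g := φ)
      ((by simp only [hgd]; fun_prop : Continuous fun x =>
        fderiv ℝ (fun x : E d => ⟪p, x⟫ + b) x e * φ x).integrable_of_hasCompactSupport hφc.mul_left)
      ((hg.continuous.mul hdφ).integrable_of_hasCompactSupport (hφc.fderiv_apply ℝ e).mul_left)
      ((hg.continuous.mul hφ.continuous).integrable_of_hasCompactSupport hφc.mul_left)
      (fun x _ => hg x) (fun x _ => hφ.differentiable (by simp) x)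
    have h1 := integral_inner_snd_mul hv hφ hφc e
    rw [i1, i3] at h1
    simp only [hgd] at h1
    simp only [smul_eq_mul, inner_sub_left, mul_sub]
    rw [integral_sub, h1, i2, neg_neg, sub_self]
    · exact hloc.integrable_smul_left_of_hasCompactSupport hφ.continuous hφc
    · exact ((hφ.continuous.mul continuous_const).integrable_of_hasCompactSupport
        hφc.mul_right).restrict
  have hall := ae_all_iff.2 fun i : Fin d => key (EuclideanSpace.single i 1)
  filter_upwards [hall] with x hx hxO
  ext i
  have := hx i hxO
  rw [EuclideanSpace.inner_single_right] at this
  simpa [sub_eq_zero] using this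

variable {𝒯 : Mesh d}

theorem ae_snd_eq_elemGrad {V : L2Pair Ω} (hV : V ∈ feSpace Ω 𝒯) {T : TaggedSimplex d}
    (hT : T ∈ 𝒯) (hTΩ : interior T.carrier ⊆ Ω) (hT0 : volume T.carrier ≠ 0) :
    ∀ᵐ x ∂(volume.restrict (interior T.carrier)), V.2 x = elemGrad Ω V T := by
  obtain ⟨p, b, hp⟩ := hV.2 T hT
  have h1 := ae_snd_eq_of_ae_fst_eq hV.1 isOpen_interior hTΩ (p := p) (b := b)
    (hp.mono fun x hx hxT => hx (interior_subset hxT))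
  have h2 : ∀ᵐ x ∂(volume.restrict (interior T.carrier)), V.2 x = p := by
    have := ae_mono (Measure.restrict_mono hTΩ le_rfl) h1
    filter_upwards [this, ae_restrict_mem isOpen_interior.measurableSet] with x hx hxT
    exact hx hxT
  have h3 : elemGrad Ω V T = p := by
    rw [elemGrad, T.restrict_interior] at *
    have : NeZero (volume.restrict T.carrier) := ⟨by simpa using hT0⟩
    have : IsFiniteMeasure (volume.restrict T.carrier) := ⟨by simpa using T.volume_carrier_lt_top⟩
    rw [average_congr h2, average_const]
  rw [h3]
  exact h2

theorem sum_volume_mul_norm_elemGrad_sub_le (hΩ : interior (closure Ω) = Ω)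
    (h𝒯 : IsConformingTriangulation Ω 𝒯) (h0 : ∀ T ∈ 𝒯, volume T.carrier ≠ 0)
    {V W : L2Pair Ω} (hV : V ∈ feSpace Ω 𝒯) (hW : W ∈ feSpace Ω 𝒯) :
    ∑ T ∈ 𝒯, volume.real T.carrier * ‖elemGrad Ω V T - elemGrad Ω W T‖ ^ 2 ≤ ‖(V - W).2‖ ^ 2 := by
  have hint : Integrable (fun x => ⟪(V - W).2 x, (V - W).2 x⟫) (vol Ω) := L2.integrable_inner _ _
  have hsub := fun T (hT : T ∈ 𝒯) => h𝒯.interior_subset hΩ hT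
  have h1 : ∀ T ∈ 𝒯, volume.real T.carrier * ‖elemGrad Ω V T - elemGrad Ω W T‖ ^ 2 =
      ∫ x in interior T.carrier, ⟪(V - W).2 x, (V - W).2 x⟫ := by
    intro T hT
    have hs := ae_mono (Measure.restrict_mono (hsub T hT) le_rfl) (Lp.coeFn_sub V.2 W.2)
    have : ∫ x in interior T.carrier, ⟪(V - W).2 x, (V - W).2 x⟫ =
        ∫ x in interior T.carrier, ‖elemGrad Ω V T - elemGrad Ω W T‖ ^ 2 := by
      refine integral_congr_ae ?_
      filter_upwards [ae_snd_eq_elemGrad hV hT (hsub T hT) (h0 T hT),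
        ae_snd_eq_elemGrad hW hT (hsub T hT) (h0 T hT), hs] with x hx1 hx2 hx3
      rw [Prod.snd_sub, hx3, Pi.sub_apply, hx1, hx2, real_inner_self_eq_norm_sq]
    rw [this, T.restrict_interior, setIntegral_const, smul_eq_mul]
  rw [Finset.sum_congr rfl h1, ← integral_biUnion_finset, ← real_inner_self_eq_norm_sq,
    L2.inner_def]
  · exact setIntegral_mono_set hint (ae_of_all _ fun x => real_inner_self_nonneg)
      (LE.le.eventuallyLE (iUnion₂_subset hsub))
  · exact fun T _ => isOpen_interior.measurableSet
  · exact fun T hT T' hT' h => (h𝒯.2 T hT T' hT' h).1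
  · exact fun T hT => hint.mono_measure (Measure.restrict_mono (hsub T hT) le_rfl)

/-- A bump function with vanishing gradient would be constant, which contradicts compact support.
Such an element is what forces `cA ≤ CA`. -/
theorem exists_mem_H10_snd_ne_zero [NeZero d] (hΩo : IsOpen Ω) (hΩ : Ω.Nonempty) :
    ∃ w ∈ H10 Ω, w.2 ≠ 0 := by
  obtain ⟨c, hc⟩ := hΩ
  obtain ⟨φ, hφ1, hφ2, hφ3, -, hφ5⟩ := exists_contDiff_tsupport_subset (n := ⊤) (hΩo.mem_nhds hc)
  have m1 : MemLp φ 2 (vol Ω) := (hφ3.continuous.memLp_of_hasCompactSupport hφ2).restrict Ω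
  have m2 : MemLp (gradient φ) 2 (vol Ω) :=
    ((contDiff_gradient_continuous hφ3).memLp_of_hasCompactSupport
      (hasCompactSupport_gradient hφ2)).restrict Ω
  refine ⟨(m1.toLp _, m2.toLp _), Submodule.le_topologicalClosure _ (Submodule.subset_span
    ⟨φ, hφ3, hφ2, hφ1, m1.coeFn_toLp, m2.coeFn_toLp⟩), fun h0 => ?_⟩
  have h1 : gradient φ =ᵐ[vol Ω] 0 := by
    have := m2.coeFn_toLp
    have h0' : m2.toLp _ = 0 := h0
    rw [h0'] at this
    exact this.symm.trans (Lp.coeFn_zero _ _ _)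
  have h2 : ∀ᵐ x ∂(volume : Measure (E d)), gradient φ x = 0 := by
    filter_upwards [(ae_restrict_iff' hΩo.measurableSet).1 h1] with x hx
    by_cases hxΩ : x ∈ Ω
    · exact hx hxΩ
    · have : fderiv ℝ φ x = 0 := fderiv_of_notMem_tsupport ℝ fun h => hxΩ (hφ1 h)
      rw [gradient, this, map_zero]
  have h3 : gradient φ = 0 :=
    Continuous.ae_eq_iff_eq volume (contDiff_gradient_continuous hφ3) continuous_zero |>.1 h2
  have h4 : ∀ x, fderiv ℝ φ x = 0 := fun x => by
    ext e
    rw [← inner_gradient_left, h3, Pi.zero_apply, inner_zero_left]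
    rfl
  have h5 := is_const_of_fderiv_eq_zero (hφ3.differentiable (by simp)) h4
  obtain ⟨z, hz⟩ : ∃ z, z ∉ tsupport φ := by
    by_contra! h
    have : IsCompact (univ : Set (E d)) := (eq_univ_of_forall h) ▸ hφ2
    exact (noncompact_univ (E d)) this
  have := h5 c z
  rw [hφ5, image_eq_zero_of_notMem_tsupport hz] at this
  exact one_ne_zero this

theorem monotoneConst_le_lipschitzConst [NeZero d] (hΩo : IsOpen Ω) (hΩ : Ω.Nonempty)
    {α : E d → ℝ → ℝ} {cA CA : ℝ} (hm : IsMonotoneConst Ω α cA) (hl : IsLipschitzConst Ω α CA) :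
    cA ≤ CA := by
  obtain ⟨w, hw, hw0⟩ := exists_mem_H10_snd_ne_zero hΩo hΩ
  have h1 := hm w hw 0 (zero_mem _)
  have h2 := (le_abs_self _).trans (hl w hw 0 (zero_mem _) (w - 0) (by simpa using hw))
  have h3 := h1.trans h2
  simp only [sub_zero] at h3
  have : 0 < ‖w.2‖ ^ 2 := by positivity
  exact le_of_mul_le_mul_right (by linarith) this

end WeakGradient

/-! ### Residuals -/

section Residuals

variable {d : ℕ} {Ω : Set (E d)} {α : E d → ℝ → ℝ} {ca Ca Λ : ℝ} {𝒯 : Mesh d}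

theorem TaggedSimplex.affineSpan_eq_top (T : TaggedSimplex d) :
    affineSpan ℝ (range T.simplex.points) = ⊤ := by
  rw [T.simplex.independent.affineSpan_eq_top_iff_card_eq_finrank_add_one]
  simp

theorem TaggedSimplex.interior_nonempty (T : TaggedSimplex d) : (interior T.carrier).Nonempty := by
  rw [carrier, interior_convexHull_nonempty_iff_affineSpan_eq_top, T.affineSpan_eq_top]

theorem TaggedSimplex.volume_carrier_ne_zero (T : TaggedSimplex d) : volume T.carrier ≠ 0 :=
  ((isOpen_interior.measure_pos volume T.interior_nonempty).trans_le
    (measure_mono interior_subset)).ne'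

theorem TaggedSimplex.closure_interior (T : TaggedSimplex d) :
    closure (interior T.carrier) = T.carrier := by
  rw [T.convex_carrier.closure_interior_eq_closure_of_nonempty_interior T.interior_nonempty,
    T.isCompact_carrier.isClosed.closure_eq]

theorem TaggedSimplex.side_subset (T : TaggedSimplex d) (i : Fin (d + 1)) :
    T.side i ⊆ T.carrier :=
  convexHull_mono (image_subset_range _ _)

theorem TaggedSimplex.isCompact_side (T : TaggedSimplex d) (i : Fin (d + 1)) :
    IsCompact (T.side i) :=
  ((finite_range T.simplex.points).subset (image_subset_range _ _)).isCompact_convexHull ℝ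

theorem TaggedSimplex.norm_normal_le [NeZero d] (T : TaggedSimplex d) (i : Fin (d + 1)) :
    ‖T.normal i‖ ≤ 1 := by
  rw [normal, norm_smul, norm_inv, norm_norm]
  exact inv_mul_le_one

theorem norm_flux_sub_flux_le' (hα : IsAdmissibleCoeff Ω α ca Ca)
    (hΛ : IsPiecewiseLipschitz 𝒯 α Λ) {T : TaggedSimplex d} (hT : T ∈ 𝒯)
    (hTΩ : interior T.carrier ⊆ Ω) (p q : E d) {x y : E d} (hx : x ∈ interior T.carrier)
    (hy : y ∈ interior T.carrier) :
    ‖(α x (‖p‖ ^ 2) • p - α x (‖q‖ ^ 2) • q) - (α y (‖p‖ ^ 2) • p - α y (‖q‖ ^ 2) • q)‖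
      ≤ 3 * Λ * ‖p - q‖ * ‖x - y‖ :=
  norm_flux_sub_flux_le hα hTΩ hx hy (fun t ht => hΛ T hT x hx y hy t ht) p q

theorem norm_flux_sub_le_dist (hα : IsAdmissibleCoeff Ω α ca Ca)
    (hΛ : IsPiecewiseLipschitz 𝒯 α Λ) {T : TaggedSimplex d} (hT : T ∈ 𝒯)
    (hTΩ : interior T.carrier ⊆ Ω) (p : E d) {x y : E d} (hx : x ∈ interior T.carrier)
    (hy : y ∈ interior T.carrier) :
    ‖α x (‖p‖ ^ 2) • p - α y (‖p‖ ^ 2) • p‖ ≤ 3 * Λ * ‖p‖ * ‖x - y‖ := by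
  simpa using norm_flux_sub_flux_le' hα hΛ hT hTΩ p 0 hx hy

theorem ae_differentiableAt_flux (hα : IsAdmissibleCoeff Ω α ca Ca)
    (hΛ : IsPiecewiseLipschitz 𝒯 α Λ) {T : TaggedSimplex d} (hT : T ∈ 𝒯)
    (hTΩ : interior T.carrier ⊆ Ω) (p : E d) :
    ∀ᵐ x ∂(volume : Measure (E d)), x ∈ interior T.carrier →
      DifferentiableAt ℝ (fun y => α y (‖p‖ ^ 2) • p) x := by
  have hL : LipschitzOnWith (3 * Λ * ‖p‖).toNNReal (fun y => α y (‖p‖ ^ 2) • p)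
      (interior T.carrier) := by
    refine LipschitzOnWith.of_dist_le_mul fun x hx y hy => ?_
    rw [dist_eq_norm, dist_eq_norm]
    exact (norm_flux_sub_le_dist hα hΛ hT hTΩ p hx hy).trans
      (mul_le_mul_of_nonneg_right (Real.le_coe_toNNReal _) (norm_nonneg _))
  filter_upwards [hL.ae_differentiableWithinAt_of_mem (μ := volume)] with x hx hxT
  exact (hx hxT).differentiableAt (isOpen_interior.mem_nhds hxT)

theorem abs_sum_apply_le {L : E d →L[ℝ] E d} {C : ℝ} (hL : ‖L‖ ≤ C) :
    |∑ i : Fin d, (L (EuclideanSpace.single i 1)) i| ≤ d * C := by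
  refine (Finset.abs_sum_le_sum_abs _ _).trans ?_
  refine (Finset.sum_le_card_nsmul _ _ C fun i _ => ?_).trans (by simp)
  refine ((PiLp.norm_apply_le (L (EuclideanSpace.single i 1)) i).trans (L.le_opNorm _)).trans ?_
  simpa using hL

/-- No differentiability is needed: a local Lipschitz bound controls `fderiv` also where it takes
its default value `0`. -/
theorem abs_divergence_flux_le (hα : IsAdmissibleCoeff Ω α ca Ca)
    (hΛ : IsPiecewiseLipschitz 𝒯 α Λ) (hΛ0 : 0 ≤ Λ) {T : TaggedSimplex d} (hT : T ∈ 𝒯)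
    (hTΩ : interior T.carrier ⊆ Ω) (p : E d) {x : E d} (hx : x ∈ interior T.carrier) :
    |divergence (fun y => α y (‖p‖ ^ 2) • p) x| ≤ d * (3 * Λ * ‖p‖) := by
  refine abs_sum_apply_le (norm_fderiv_le_of_lip' ℝ (by positivity) ?_)
  filter_upwards [isOpen_interior.mem_nhds hx] with y hy
  exact norm_flux_sub_le_dist hα hΛ hT hTΩ p hy hx

/-- The difference of divergences is the divergence of the difference only where both fields are
differentiable, which is almost everywhere by Rademacher's theorem. There the mixed Lipschitz bound
applies. -/
theorem ae_abs_divergence_sub_le (hα : IsAdmissibleCoeff Ω α ca Ca)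
    (hΛ : IsPiecewiseLipschitz 𝒯 α Λ) (hΛ0 : 0 ≤ Λ) {T : TaggedSimplex d} (hT : T ∈ 𝒯)
    (hTΩ : interior T.carrier ⊆ Ω) (p q : E d) :
    ∀ᵐ x ∂(volume : Measure (E d)), x ∈ interior T.carrier →
      |divergence (fun y => α y (‖p‖ ^ 2) • p) x - divergence (fun y => α y (‖q‖ ^ 2) • q) x|
        ≤ d * (3 * Λ * ‖p - q‖) := by
  filter_upwards [ae_differentiableAt_flux hα hΛ hT hTΩ p, ae_differentiableAt_flux hα hΛ hT hTΩ q]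
    with x hp hq hx
  have e : divergence (fun y => α y (‖p‖ ^ 2) • p) x - divergence (fun y => α y (‖q‖ ^ 2) • q) x =
      ∑ i : Fin d, (fderiv ℝ (fun y => α y (‖p‖ ^ 2) • p - α y (‖q‖ ^ 2) • q) x
        (EuclideanSpace.single i 1)) i := by
    rw [fderiv_fun_sub (hp hx) (hq hx), divergence, divergence, ← Finset.sum_sub_distrib]
    rfl
  rw [e]
  refine abs_sum_apply_le (norm_fderiv_le_of_lip' ℝ (by positivity) ?_)
  filter_upwards [isOpen_interior.mem_nhds hx] with y hy
  exact norm_flux_sub_flux_le' hα hΛ hT hTΩ p q hy hx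

theorem measurable_divergence (F : E d → E d) : Measurable (divergence F) := by
  refine Finset.measurable_sum _ fun i _ => ?_
  exact (PiLp.continuous_apply 2 (fun _ : Fin d => ℝ) i).measurable.comp
    (measurable_fderiv_apply_const ℝ F _)

theorem memLp_elemResidual (hα : IsAdmissibleCoeff Ω α ca Ca)
    (hΛ : IsPiecewiseLipschitz 𝒯 α Λ) (hΛ0 : 0 ≤ Λ) {T : TaggedSimplex d} (hT : T ∈ 𝒯)
    (hTΩ : interior T.carrier ⊆ Ω) (f : Lp ℝ 2 (vol Ω)) (V : L2Pair Ω) :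
    MemLp (elemResidual Ω α f V T) 2 (volume.restrict T.carrier) := by
  rw [← T.restrict_interior]
  have : IsFiniteMeasure (volume.restrict (interior T.carrier)) :=
    ⟨by simpa [T.restrict_interior] using T.volume_carrier_lt_top⟩
  have h1 : MemLp (fun x => -divergence (fun y => α y (‖elemGrad Ω V T‖ ^ 2) • elemGrad Ω V T) x) 2
      (volume.restrict (interior T.carrier)) := by
    refine MemLp.of_bound (measurable_divergence _).neg.aestronglyMeasurable
      (d * (3 * Λ * ‖elemGrad Ω V T‖)) ?_
    filter_upwards [ae_restrict_mem isOpen_interior.measurableSet] with x hx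
    rw [norm_neg]
    exact abs_divergence_flux_le hα hΛ hΛ0 hT hTΩ _ hx
  exact h1.sub ((Lp.memLp f).mono_measure (Measure.restrict_mono hTΩ le_rfl))

theorem integral_elemResidual_sub_sq_le (hα : IsAdmissibleCoeff Ω α ca Ca)
    (hΛ : IsPiecewiseLipschitz 𝒯 α Λ) (hΛ0 : 0 ≤ Λ) {T : TaggedSimplex d} (hT : T ∈ 𝒯)
    (hTΩ : interior T.carrier ⊆ Ω) (f : Lp ℝ 2 (vol Ω)) (V W : L2Pair Ω) :
    ∫ x in T.carrier, (elemResidual Ω α f V T x - elemResidual Ω α f W T x) ^ 2 ≤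
      (d * (3 * Λ)) ^ 2 * (volume.real T.carrier * ‖elemGrad Ω V T - elemGrad Ω W T‖ ^ 2) := by
  rw [← T.restrict_interior]
  have h0 : volume (interior T.carrier) < ⊤ :=
    (measure_mono interior_subset).trans_lt T.volume_carrier_lt_top
  have hb := norm_setIntegral_le_of_norm_le_const_ae' (μ := volume) (s := interior T.carrier)
    (f := fun x => (elemResidual Ω α f V T x - elemResidual Ω α f W T x) ^ 2)
    (C := (d * (3 * Λ * ‖elemGrad Ω V T - elemGrad Ω W T‖)) ^ 2) h0 (by
      filter_upwards [ae_abs_divergence_sub_le hα hΛ hΛ0 hT hTΩ (elemGrad Ω V T) (elemGrad Ω W T)]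
        with x hx hxT
      have e : (elemResidual Ω α f V T x - elemResidual Ω α f W T x) ^ 2 =
          |divergence (fun y => α y (‖elemGrad Ω V T‖ ^ 2) • elemGrad Ω V T) x -
            divergence (fun y => α y (‖elemGrad Ω W T‖ ^ 2) • elemGrad Ω W T) x| ^ 2 := by
        rw [sq_abs, elemResidual, elemResidual]
        ring
      rw [e, Real.norm_of_nonneg (by positivity)]
      exact pow_le_pow_left₀ (abs_nonneg _) (hx hxT) 2)
  refine (le_abs_self _).trans (hb.trans ?_)
  have : volume.real (interior T.carrier) ≤ volume.real T.carrier :=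
    measureReal_mono interior_subset T.volume_carrier_lt_top.ne
  calc _ ≤ (d * (3 * Λ * ‖elemGrad Ω V T - elemGrad Ω W T‖)) ^ 2 * volume.real T.carrier := by
        gcongr
    _ = _ := by ring

/-! ### Traces of the flux and jumps -/

/-- A Lipschitz extension beyond the interior shows that `limUnder` is a true limit up to the
boundary, with continuous values. -/
theorem exists_continuous_trace (hα : IsAdmissibleCoeff Ω α ca Ca)
    (hΛ : IsPiecewiseLipschitz 𝒯 α Λ) {T : TaggedSimplex d} (hT : T ∈ 𝒯)
    (hTΩ : interior T.carrier ⊆ Ω) {t : ℝ} (ht : 0 ≤ t) :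
    ∃ g : E d → ℝ, Continuous g ∧ EqOn (fun y => α y t) g (interior T.carrier) ∧
      ∀ x ∈ T.carrier, limUnder (𝓝[interior T.carrier] x) (fun y => α y t) = g x := by
  have hL : LipschitzOnWith Λ.toNNReal (fun y => α y t) (interior T.carrier) := by
    refine LipschitzOnWith.of_dist_le_mul fun x hx y hy => ?_
    rw [dist_eq_norm, dist_eq_norm]
    exact (hΛ.abs_sub_le hα hT hTΩ hx hy ht).trans
      (mul_le_mul_of_nonneg_right (Real.le_coe_toNNReal _) (norm_nonneg _))
  obtain ⟨g, hg, hgeq⟩ := hL.extend_real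
  refine ⟨g, hg.continuous, hgeq, fun x hx => ?_⟩
  have : (𝓝[interior T.carrier] x).NeBot :=
    mem_closure_iff_nhdsWithin_neBot.1 (T.closure_interior.symm ▸ hx)
  refine Tendsto.limUnder_eq ?_
  refine ((hg.continuous.tendsto x).mono_left nhdsWithin_le_nhds).congr' ?_
  filter_upwards [self_mem_nhdsWithin] with y hy
  exact (hgeq hy).symm

theorem continuousOn_fluxTrace (hα : IsAdmissibleCoeff Ω α ca Ca)
    (hΛ : IsPiecewiseLipschitz 𝒯 α Λ) {T : TaggedSimplex d} (hT : T ∈ 𝒯)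
    (hTΩ : interior T.carrier ⊆ Ω) (V : L2Pair Ω) :
    ContinuousOn (fluxTrace Ω α V T) T.carrier := by
  obtain ⟨g, hg, -, hlim⟩ := exists_continuous_trace hα hΛ hT hTΩ (sq_nonneg ‖elemGrad Ω V T‖)
  refine (hg.smul continuous_const).continuousOn.congr (f := fun x => g x • elemGrad Ω V T) ?_
  intro x hx
  rw [fluxTrace, hlim x hx]

/-- The bound is a closed condition on the extended coefficients and holds in the interior, which is
dense in the element. -/
theorem norm_fluxTrace_sub_le (hα : IsAdmissibleCoeff Ω α ca Ca) (hca : 0 < ca)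
    (hΛ : IsPiecewiseLipschitz 𝒯 α Λ) {T : TaggedSimplex d} (hT : T ∈ 𝒯)
    (hTΩ : interior T.carrier ⊆ Ω) (V W : L2Pair Ω) {x : E d} (hx : x ∈ T.carrier) :
    ‖fluxTrace Ω α V T x - fluxTrace Ω α W T x‖ ≤ Ca * ‖elemGrad Ω V T - elemGrad Ω W T‖ := by
  obtain ⟨g, hg, hgeq, hglim⟩ :=
    exists_continuous_trace hα hΛ hT hTΩ (sq_nonneg ‖elemGrad Ω V T‖)
  obtain ⟨h, hh, hheq, hhlim⟩ :=
    exists_continuous_trace hα hΛ hT hTΩ (sq_nonneg ‖elemGrad Ω W T‖)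
  rw [fluxTrace, fluxTrace, hglim x hx, hhlim x hx]
  have hcl : IsClosed {y | ‖g y • elemGrad Ω V T - h y • elemGrad Ω W T‖ ≤
      Ca * ‖elemGrad Ω V T - elemGrad Ω W T‖} := isClosed_le (by fun_prop) continuous_const
  refine closure_minimal ?_ hcl (T.closure_interior.symm ▸ hx)
  intro y hy
  have h1 := hgeq hy
  have h2 := hheq hy
  simp only at h1 h2
  rw [mem_ofPred_eq, ← h1, ← h2]
  exact hα.norm_flux_sub_le hca (hTΩ hy) _ _

theorem continuousOn_jumpResidual [NeZero d] (hα : IsAdmissibleCoeff Ω α ca Ca)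
    (hΛ : IsPiecewiseLipschitz 𝒯 α Λ) (hTΩ : ∀ T ∈ 𝒯, interior T.carrier ⊆ Ω) (V : L2Pair Ω)
    (S : Set (E d)) : ContinuousOn (jumpResidual Ω α 𝒯 V S) S := by
  unfold jumpResidual
  split_ifs
  · exact continuousOn_const
  refine continuousOn_const.mul (continuousOn_finsetSum _ fun T hT =>
    continuousOn_finsetSum _ fun i _ => ?_)
  split_ifs with h
  · have hS : S ⊆ T.carrier := h ▸ T.side_subset i
    exact ((continuousOn_fluxTrace hα hΛ hT (hTΩ T hT) V).mono hS).inner continuousOn_const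
  · exact continuousOn_const

open Classical in
/-- The elements of the mesh that have `S` as a side. -/
def elementsAt (𝒯 : Mesh d) (S : Set (E d)) : Finset (TaggedSimplex d) :=
  𝒯.filter fun T => ∃ i, T.side i = S

theorem abs_jumpResidual_sub_le [NeZero d] (hα : IsAdmissibleCoeff Ω α ca Ca) (hca : 0 < ca)
    (hΛ : IsPiecewiseLipschitz 𝒯 α Λ) (hTΩ : ∀ T ∈ 𝒯, interior T.carrier ⊆ Ω) (V W : L2Pair Ω)
    {S : Set (E d)} {x : E d} (hx : x ∈ S) (hCa : 0 ≤ Ca) :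
    |jumpResidual Ω α 𝒯 V S x - jumpResidual Ω α 𝒯 W S x| ≤
      (d + 1) * Ca * ∑ T ∈ elementsAt 𝒯 S, ‖elemGrad Ω V T - elemGrad Ω W T‖ := by
  have hr : 0 ≤ (d + 1) * Ca * ∑ T ∈ elementsAt 𝒯 S, ‖elemGrad Ω V T - elemGrad Ω W T‖ := by
    positivity
  unfold jumpResidual
  split_ifs
  · simpa using hr
  rw [← mul_sub, ← Finset.sum_sub_distrib]
  simp_rw [← Finset.sum_sub_distrib]
  have hT : ∀ T ∈ 𝒯, |∑ i : Fin (d + 1),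
      ((if T.side i = S then ⟪fluxTrace Ω α V T x, T.normal i⟫ else 0) -
        if T.side i = S then ⟪fluxTrace Ω α W T x, T.normal i⟫ else 0)| ≤
      if ∃ i, T.side i = S then (d + 1) * Ca * ‖elemGrad Ω V T - elemGrad Ω W T‖ else 0 := by
    intro T hT
    split_ifs with h
    · refine (Finset.abs_sum_le_sum_abs _ _).trans ?_
      -- All `d + 1` indices are counted, although only one side of `T` can equal `S`.
      refine (Finset.sum_le_card_nsmul _ _ (Ca * ‖elemGrad Ω V T - elemGrad Ω W T‖)
        fun i _ => ?_).trans (by simp [mul_assoc])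
      split_ifs with hi
      · rw [← inner_sub_left]
        refine (abs_real_inner_le_norm _ _).trans ?_
        refine (mul_le_of_le_one_right (norm_nonneg _) (T.norm_normal_le i)).trans ?_
        exact norm_fluxTrace_sub_le hα hca hΛ hT (hTΩ T hT) V W (T.side_subset i (hi ▸ hx))
      · simp only [sub_self, abs_zero]
        positivity
    · push Not at h
      simp [h]
  have hsum : |∑ T ∈ 𝒯, ∑ i : Fin (d + 1),
      ((if T.side i = S then ⟪fluxTrace Ω α V T x, T.normal i⟫ else 0) -
        if T.side i = S then ⟪fluxTrace Ω α W T x, T.normal i⟫ else 0)| ≤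
      (d + 1) * Ca * ∑ T ∈ elementsAt 𝒯 S, ‖elemGrad Ω V T - elemGrad Ω W T‖ := by
    refine (Finset.abs_sum_le_sum_abs _ _).trans ((Finset.sum_le_sum hT).trans ?_)
    rw [elementsAt, Finset.mul_sum, Finset.sum_filter]
  rw [abs_mul, abs_of_pos (by norm_num : (0 : ℝ) < 1 / 2)]
  linarith [abs_nonneg (∑ T ∈ 𝒯, ∑ i : Fin (d + 1),
      ((if T.side i = S then ⟪fluxTrace Ω α V T x, T.normal i⟫ else 0) -
        if T.side i = S then ⟪fluxTrace Ω α W T x, T.normal i⟫ else 0))]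

end Residuals

/-! ### Geometry of shape regular elements -/

section Geometry

variable {d : ℕ}

theorem TaggedSimplex.diam_side_le (T : TaggedSimplex d) (i : Fin (d + 1)) :
    Metric.diam (T.side i) ≤ Metric.diam T.carrier :=
  Metric.diam_mono (T.side_subset i) T.isCompact_carrier.isBounded

/-- The vertices of a simplex as an affine basis. -/
def TaggedSimplex.affineBasis (T : TaggedSimplex d) : AffineBasis (Fin (d + 1)) ℝ (E d) :=
  ⟨T.simplex.points, T.simplex.independent, T.affineSpan_eq_top⟩

theorem TaggedSimplex.coord_eq_zero_of_mem_side (T : TaggedSimplex d) {i : Fin (d + 1)} {x : E d}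
    (hx : x ∈ T.side i) : T.affineBasis.coord i x = 0 := by
  have hc : Convex ℝ {x | T.affineBasis.coord i x = 0} :=
    (convex_singleton (0 : ℝ)).affine_preimage (T.affineBasis.coord i)
  refine convexHull_min ?_ hc hx
  rintro _ ⟨j, hj, rfl⟩
  exact T.affineBasis.coord_apply_ne fun h => hj h.symm

theorem TaggedSimplex.side_nonempty (hd : 2 ≤ d) (T : TaggedSimplex d) (i : Fin (d + 1)) :
    (T.side i).Nonempty := by
  have : Nontrivial (Fin (d + 1)) := Fin.nontrivial_iff_two_le.2 (by omega)
  obtain ⟨j, hj⟩ := exists_ne i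
  exact ⟨_, subset_convexHull ℝ _ ⟨j, hj, rfl⟩⟩

theorem TaggedSimplex.exists_eq_of_mem_carrier (hd : 2 ≤ d) (T : TaggedSimplex d)
    (i : Fin (d + 1)) {x : E d} (hx : x ∈ T.carrier) :
    ∃ s ∈ T.side i, 0 ≤ T.affineBasis.coord i x ∧ T.affineBasis.coord i x ≤ 1 ∧
      x = T.affineBasis.coord i x • T.simplex.points i + (1 - T.affineBasis.coord i x) • s := by
  have hr : range T.simplex.points = insert (T.simplex.points i) (T.simplex.points '' {i}ᶜ) := by
    rw [← image_insert_eq, ← image_univ]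
    congr 1
    ext j
    simp [em]
  have hne : (T.simplex.points '' {i}ᶜ).Nonempty :=
    convexHull_nonempty_iff.1 (T.side_nonempty hd i)
  rw [carrier, hr, convexHull_insert hne, mem_convexJoin] at hx
  obtain ⟨y, rfl, s, hs, a, b, ha, hb, hab, rfl⟩ := hx
  have hs' : T.affineBasis.coord i s = 0 := T.coord_eq_zero_of_mem_side hs
  have hi : T.affineBasis.coord i (T.simplex.points i) = 1 := T.affineBasis.coord_apply_eq i
  have hc : T.affineBasis.coord i (a • T.simplex.points i + b • s) = a := by
    rw [Convex.combo_affine_apply hab, hs', hi]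
    simp
  rw [hc]
  exact ⟨s, hs, ha, by linarith, by rw [← hab, add_sub_cancel_left]⟩

/-- From the centre `c`, move by `r` parallel to the side. Both points keep the barycentric
coordinate `a` of the opposite vertex, and projecting them from that vertex onto the side magnifies
their distance by `1 / (1 - a)`. -/
theorem TaggedSimplex.le_diam_side_of_closedBall_subset (hd : 2 ≤ d) (T : TaggedSimplex d)
    (i : Fin (d + 1)) {c : E d} {r : ℝ} (hr : 0 ≤ r) (hc : Metric.closedBall c r ⊆ T.carrier) :
    r ≤ Metric.diam (T.side i) := by
  have hcard : 1 < (({i} : Finset (Fin (d + 1)))ᶜ).card := by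
    rw [Finset.card_compl, Fintype.card_fin, Finset.card_singleton]
    omega
  obtain ⟨j, hj, k, hk, hjk⟩ := Finset.one_lt_card.1 hcard
  simp only [Finset.mem_compl, Finset.mem_singleton] at hj hk
  -- The direction parallel to the side comes from two of its vertices; `2 ≤ d` ensures that there
  -- are two.
  set v := T.simplex.points j - T.simplex.points k with hv
  have hv0 : v ≠ 0 := sub_ne_zero.2 (T.simplex.independent.injective.ne hjk)
  have hvn : 0 < ‖v‖ := norm_pos_iff.2 hv0
  set e := (r / ‖v‖) • v with he
  have hen : ‖e‖ = r := by
    rw [he, norm_smul, Real.norm_of_nonneg (by positivity), div_mul_cancel₀ _ hvn.ne']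
  obtain ⟨s₁, hs₁, h₁, h₁', e₁⟩ := T.exists_eq_of_mem_carrier hd i (hc (by simp [hen] :
    c + e ∈ Metric.closedBall c r))
  obtain ⟨s₂, hs₂, -, -, e₂⟩ := T.exists_eq_of_mem_carrier hd i (hc (Metric.mem_closedBall_self hr))
  have hcoord : T.affineBasis.coord i (c + e) = T.affineBasis.coord i c := by
    have hlin : (T.affineBasis.coord i).linear v = 0 := by
      have : (T.affineBasis.coord i).linear (T.simplex.points j -ᵥ T.simplex.points k) = _ :=
        (T.affineBasis.coord i).linearMap_vsub _ _
      rw [hv, ← vsub_eq_sub, this]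
      have h1 : T.affineBasis.coord i (T.simplex.points j) = 0 :=
        T.affineBasis.coord_apply_ne fun h => hj h.symm
      have h2 : T.affineBasis.coord i (T.simplex.points k) = 0 :=
        T.affineBasis.coord_apply_ne fun h => hk h.symm
      rw [h1, h2, vsub_eq_sub, sub_zero]
    have := (T.affineBasis.coord i).map_vadd c e
    rwa [vadd_eq_add, add_comm e c, he, map_smul, hlin, smul_zero, zero_vadd] at this
  rw [hcoord] at e₁ h₁ h₁'
  set a := T.affineBasis.coord i c
  have hes : e = (1 - a) • (s₁ - s₂) := by
    calc e = (c + e) - c := by abel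
      _ = (a • T.simplex.points i + (1 - a) • s₁) - (a • T.simplex.points i + (1 - a) • s₂) :=
        congrArg₂ _ e₁ e₂
      _ = _ := by module
  calc r = ‖e‖ := hen.symm
    _ = (1 - a) * ‖s₁ - s₂‖ := by rw [hes, norm_smul, Real.norm_of_nonneg (by linarith)]
    _ ≤ 1 * ‖s₁ - s₂‖ := by gcongr; linarith
    _ = dist s₁ s₂ := by rw [one_mul, dist_eq_norm]
    _ ≤ _ := Metric.dist_le_diam_of_mem (T.isCompact_side i).isBounded hs₁ hs₂

theorem TaggedSimplex.bddAbove_radii (hd : 2 ≤ d) (T : TaggedSimplex d) :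
    BddAbove {r : ℝ | 0 ≤ r ∧ ∃ c : E d, Metric.closedBall c r ⊆ T.carrier} :=
  ⟨_, fun _ ⟨hr, _, hc⟩ => T.le_diam_side_of_closedBall_subset hd 0 hr hc⟩

theorem TaggedSimplex.inradius_le_diam_side (hd : 2 ≤ d) (T : TaggedSimplex d)
    (i : Fin (d + 1)) : T.inradius ≤ Metric.diam (T.side i) :=
  Real.sSup_le (fun _ ⟨hr, _, hc⟩ => T.le_diam_side_of_closedBall_subset hd i hr hc)
    Metric.diam_nonneg

theorem TaggedSimplex.inradius_pos (hd : 2 ≤ d) (T : TaggedSimplex d) : 0 < T.inradius := by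
  obtain ⟨c, hc⟩ := T.interior_nonempty
  obtain ⟨r, hr, hrc⟩ := Metric.nhds_basis_closedBall.mem_iff.1 (isOpen_interior.mem_nhds hc)
  exact hr.trans_le (le_csSup (T.bddAbove_radii hd) ⟨hr.le, c, hrc.trans interior_subset⟩)

theorem volume_real_closedBall (c : E d) {r : ℝ} (hr : 0 ≤ r) :
    volume.real (Metric.closedBall c r) = r ^ d * volume.real (Metric.ball (0 : E d) 1) := by
  rw [measureReal_def, Measure.addHaar_closedBall _ _ hr, ENNReal.toReal_mul,
    ENNReal.toReal_ofReal (by positivity), finrank_euclideanSpace_fin, measureReal_def]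

theorem volume_real_unitBall_pos : 0 < volume.real (Metric.ball (0 : E d) 1) :=
  ENNReal.toReal_pos (Metric.measure_ball_pos volume _ one_pos).ne' measure_ball_lt_top.ne

/-- Halving the radius avoids showing that the supremum is attained. -/
theorem TaggedSimplex.inradius_pow_le (hd : 2 ≤ d) (T : TaggedSimplex d) :
    (T.inradius / 2) ^ d * volume.real (Metric.ball (0 : E d) 1) ≤ volume.real T.carrier := by
  have h0 := T.inradius_pos hd
  obtain ⟨r, ⟨hr0, c, hc⟩, hr⟩ := exists_lt_of_lt_csSup
    (s := {r : ℝ | 0 ≤ r ∧ ∃ c : E d, Metric.closedBall c r ⊆ T.carrier})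
    ⟨0, le_rfl, T.simplex.points 0, by
      rw [Metric.closedBall_zero, singleton_subset_iff]
      exact subset_convexHull ℝ _ (mem_range_self 0)⟩
    (half_lt_self h0)
  have hr' : T.inradius / 2 ≤ r := hr.le
  calc _ ≤ r ^ d * volume.real (Metric.ball (0 : E d) 1) := by gcongr
    _ = _ := (volume_real_closedBall c hr0).symm
    _ ≤ _ := measureReal_mono hc T.volume_carrier_lt_top.ne

theorem TaggedSimplex.subset_closedBall (T : TaggedSimplex d) {x : E d} (hx : x ∈ T.carrier) :
    T.carrier ⊆ Metric.closedBall x (Metric.diam T.carrier) := fun _ hy =>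
  Metric.dist_le_diam_of_mem T.isCompact_carrier.isBounded hy hx

theorem TaggedSimplex.volume_real_le (T : TaggedSimplex d) :
    volume.real T.carrier ≤
      Metric.diam T.carrier ^ d * volume.real (Metric.ball (0 : E d) 1) := by
  rw [← volume_real_closedBall (T.simplex.points 0) Metric.diam_nonneg]
  exact measureReal_mono (T.subset_closedBall (subset_convexHull ℝ _ (mem_range_self 0)))
    measure_closedBall_lt_top.ne

theorem TaggedSimplex.meshSize_nonneg (T : TaggedSimplex d) : 0 ≤ T.meshSize :=
  Real.rpow_nonneg measureReal_nonneg _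

theorem TaggedSimplex.meshSize_le (hd : 2 ≤ d) (T : TaggedSimplex d) :
    T.meshSize ≤ volume.real (Metric.ball (0 : E d) 1) ^ (1 / (d : ℝ)) *
      Metric.diam T.carrier := by
  have hd0 : d ≠ 0 := by omega
  calc T.meshSize ≤ (Metric.diam T.carrier ^ d * volume.real (Metric.ball (0 : E d) 1)) ^
        (1 / (d : ℝ)) := Real.rpow_le_rpow measureReal_nonneg T.volume_real_le (by positivity)
    _ = _ := by
      rw [Real.mul_rpow (pow_nonneg Metric.diam_nonneg _) measureReal_nonneg, one_div,
        Real.pow_rpow_inv_natCast Metric.diam_nonneg hd0, mul_comm]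

/-- The Hausdorff measure of a side is bounded by a power of its diameter. -/
theorem exists_measure_side_le (d : ℕ) [NeZero d] : ∃ C : ℝ, 0 ≤ C ∧
    ∀ (T : TaggedSimplex d) (i : Fin (d + 1)), μHE[d - 1] (T.side i) ≤
      ENNReal.ofReal (C * Metric.diam (T.side i) ^ (d - 1)) := by
  obtain ⟨n, rfl⟩ := Nat.exists_eq_succ_of_ne_zero (NeZero.ne d)
  rw [Nat.succ_eq_add_one, Nat.add_sub_cancel]
  -- The factor that normalises `μHE[n]` against `μH[n]`.
  set c := Measure.addHaarScalarFactor (volume : Measure (EuclideanSpace ℝ (Fin n))) μH[n]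
  refine ⟨c * (n : ℝ) ^ n, by positivity, fun T i => ?_⟩
  set q : Fin (n + 1) → E (n + 1) := T.simplex.points ∘ i.succAbove with hq
  have hS : T.side i = convexHull ℝ (range q) := by
    rw [TaggedSimplex.side, hq, range_comp, Fin.range_succAbove]
  set D := Metric.diam (T.side i)
  -- The side lies in the parallelepiped spanned by its edges at one vertex. As an image of the unit
  -- cube with the sup metric, whose Hausdorff measure is `1`, it has Lipschitz constant at most `n
  -- * D`.
  set F : (Fin n → ℝ) → E (n + 1) := fun t => q 0 + ∑ m, t m • (q m.succ - q 0) with hF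
  have hsub : T.side i ⊆ F '' Icc 0 1 := by
    rw [hS]
    refine convexHull_min ?_ ?_
    · rintro _ ⟨m, rfl⟩
      refine Fin.cases ⟨0, by simp, by simp [hF]⟩ (fun m => ⟨Pi.single m 1, ?_, ?_⟩) m
      · refine ⟨Pi.single_nonneg.2 zero_le_one, fun k => ?_⟩
        rcases eq_or_ne k m with rfl | h <;> simp [*]
      · simp [hF, Pi.single_apply]
    · rintro _ ⟨s, hs, rfl⟩ _ ⟨t, ht, rfl⟩ a b ha hb hab
      refine ⟨a • s + b • t, convex_Icc _ _ hs ht ha hb hab, ?_⟩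
      have h0 : q 0 = a • q 0 + b • q 0 := by rw [← add_smul, hab, one_smul]
      simp only [hF, smul_add, Finset.smul_sum, Pi.add_apply, Pi.smul_apply, add_smul,
        Finset.sum_add_distrib, smul_eq_mul, mul_smul]
      nth_rewrite 1 [h0]
      abel
  have hlip : LipschitzOnWith (n * D).toNNReal F (Icc 0 1) := by
    refine LipschitzOnWith.of_dist_le_mul fun s _ t _ => ?_
    rw [Real.coe_toNNReal _ (by positivity), dist_eq_norm, dist_eq_norm]
    have : F s - F t = ∑ m, (s m - t m) • (q m.succ - q 0) := by
      simp only [hF, add_sub_add_left_eq_sub, ← Finset.sum_sub_distrib, sub_smul]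
    rw [this]
    refine (norm_sum_le _ _).trans ?_
    refine (Finset.sum_le_card_nsmul _ _ (‖s - t‖ * D) fun m _ => ?_).trans
      (by simp; apply le_of_eq; ring)
    rw [norm_smul]
    gcongr
    · exact norm_le_pi_norm (s - t) m
    · rw [← dist_eq_norm]
      exact Metric.dist_le_diam_of_mem (T.isCompact_side i).isBounded
        (hS ▸ subset_convexHull ℝ _ (mem_range_self _))
        (hS ▸ subset_convexHull ℝ _ (mem_range_self _))
  have hcube : μH[(n : ℝ)] (Icc (0 : Fin n → ℝ) 1) = 1 := by
    have := hausdorffMeasure_pi_real (ι := Fin n)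
    rw [Fintype.card_fin] at this
    rw [this, Real.volume_Icc_pi]
    simp
  rw [Measure.euclideanHausdorffMeasure_def, Measure.smul_apply]
  calc c • μH[(n : ℝ)] (T.side i) ≤ c • μH[(n : ℝ)] (F '' Icc 0 1) := by gcongr
    _ ≤ c • (((n * D).toNNReal : ℝ≥0∞) ^ (n : ℝ) * μH[(n : ℝ)] (Icc (0 : Fin n → ℝ) 1)) := by
      gcongr
      exact hlip.hausdorffMeasure_image_le (Nat.cast_nonneg n)
    _ = _ := by
      rw [hcube, mul_one, ENNReal.rpow_natCast, mul_assoc, ← mul_pow,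
        ENNReal.ofReal_mul (by positivity), ENNReal.ofReal_pow (by positivity)]
      simp [ENNReal.smul_def, ENNReal.ofReal]

end Geometry

/-! ### Local quasi-uniformity -/

section Patches

variable {d : ℕ} {Ω : Set (E d)} {𝒯 : Mesh d} {k : ℝ}

theorem mem_elementsAt {S : Set (E d)} {T : TaggedSimplex d} :
    T ∈ elementsAt 𝒯 S ↔ T ∈ 𝒯 ∧ ∃ i, T.side i = S := by
  simp [elementsAt]

theorem diam_le_of_mem_elementsAt (hd : 2 ≤ d) (hk0 : 0 ≤ k)
    (hk : ∀ T ∈ 𝒯, Metric.diam T.carrier ≤ k * T.inradius) {S : Set (E d)} {T : TaggedSimplex d}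
    (hT : T ∈ elementsAt 𝒯 S) : Metric.diam T.carrier ≤ k * Metric.diam S := by
  obtain ⟨hT', i, rfl⟩ := mem_elementsAt.1 hT
  exact (hk T hT').trans (mul_le_mul_of_nonneg_left (T.inradius_le_diam_side hd i) hk0)

theorem le_volume_of_mem_elementsAt (hd : 2 ≤ d) (hk0 : 0 < k)
    (hk : ∀ T ∈ 𝒯, Metric.diam T.carrier ≤ k * T.inradius) {S : Set (E d)} {T : TaggedSimplex d}
    (hT : T ∈ elementsAt 𝒯 S) :
    (Metric.diam S / (2 * k)) ^ d * volume.real (Metric.ball (0 : E d) 1) ≤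
      volume.real T.carrier := by
  obtain ⟨hT', i, rfl⟩ := mem_elementsAt.1 hT
  refine le_trans ?_ (T.inradius_pow_le hd)
  have : Metric.diam (T.side i) / (2 * k) ≤ T.inradius / 2 := by
    rw [div_le_div_iff₀ (by positivity) two_pos]
    linarith [hk T hT', T.diam_side_le i]
  gcongr

/-- A packing argument: the elements at `S` have disjoint interiors, lie in one ball of radius `k *
diam S`, and each has volume at least a multiple of `(diam S) ^ d`. -/
theorem card_elementsAt_le (hd : 2 ≤ d) (hk0 : 0 < k)
    (hk : ∀ T ∈ 𝒯, Metric.diam T.carrier ≤ k * T.inradius)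
    (h𝒯 : IsConformingTriangulation Ω 𝒯) (S : Set (E d)) :
    ((elementsAt 𝒯 S).card : ℝ) ≤ (2 * k ^ 2) ^ d := by
  rcases (elementsAt 𝒯 S).eq_empty_or_nonempty with h | ⟨T₀, hT₀⟩
  · rw [h]
    simp only [Finset.card_empty, Nat.cast_zero]
    positivity
  obtain ⟨hT₀', i₀, hi₀⟩ := mem_elementsAt.1 hT₀
  obtain ⟨s, hs⟩ := T₀.side_nonempty hd i₀
  have hD : 0 < Metric.diam S := hi₀ ▸ (T₀.inradius_pos hd).trans_le (T₀.inradius_le_diam_side hd i₀)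
  have hω := volume_real_unitBall_pos (d := d)
  have hsub : (⋃ T ∈ elementsAt 𝒯 S, interior T.carrier) ⊆
      Metric.closedBall s (k * Metric.diam S) := by
    refine iUnion₂_subset fun T hT => ?_
    obtain ⟨-, i, hi⟩ := mem_elementsAt.1 hT
    refine (interior_subset.trans (T.subset_closedBall (T.side_subset i (hi ▸ hi₀ ▸ hs)))).trans ?_
    exact Metric.closedBall_subset_closedBall (diam_le_of_mem_elementsAt hd hk0.le hk hT)
  have h1 : ∑ T ∈ elementsAt 𝒯 S, volume.real T.carrier ≤
      (k * Metric.diam S) ^ d * volume.real (Metric.ball (0 : E d) 1) := by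
    rw [← volume_real_closedBall s (by positivity)]
    have e : ∀ T ∈ elementsAt 𝒯 S, volume.real T.carrier = volume.real (interior T.carrier) :=
      fun T _ => (measureReal_congr (interior_ae_eq_of_null_frontier T.volume_frontier)).symm
    rw [Finset.sum_congr rfl e, ← measureReal_biUnion_finset
      (fun T hT T' hT' h => (h𝒯.2 T (mem_elementsAt.1 hT).1 T' (mem_elementsAt.1 hT').1 h).1)
      (fun T _ => isOpen_interior.measurableSet)
      (fun T _ => ((measure_mono interior_subset).trans_lt T.volume_carrier_lt_top).ne)]
    exact measureReal_mono hsub measure_closedBall_lt_top.ne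
  have h2 := Finset.card_nsmul_le_sum (elementsAt 𝒯 S) (fun T => volume.real T.carrier) _
    fun T hT => le_volume_of_mem_elementsAt hd hk0 hk hT
  have h3 := h2.trans h1
  rw [nsmul_eq_mul, ← mul_assoc] at h3
  have h4 := le_of_mul_le_mul_right h3 hω
  have h5 : (k * Metric.diam S) ^ d = (2 * k ^ 2) ^ d * (Metric.diam S / (2 * k)) ^ d := by
    rw [← mul_pow]
    congr 1
    field_simp
  rw [h5] at h4
  exact le_of_mul_le_mul_right h4 (by positivity)

/-- Everything is compared with `diam S`, so `T` and `T'` may be different neighbours across `S`. -/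
theorem meshSize_mul_measure_le [NeZero d] (hd : 2 ≤ d) (hk0 : 0 < k)
    (hk : ∀ T ∈ 𝒯, Metric.diam T.carrier ≤ k * T.inradius) {C : ℝ} (hC0 : 0 ≤ C)
    (hC : ∀ (T : TaggedSimplex d) (i : Fin (d + 1)), μHE[d - 1] (T.side i) ≤
      ENNReal.ofReal (C * Metric.diam (T.side i) ^ (d - 1))) {S : Set (E d)}
    {T T' : TaggedSimplex d} (hT : T ∈ elementsAt 𝒯 S) (hT' : T' ∈ elementsAt 𝒯 S) :
    T.meshSize * μHE[d - 1].real S ≤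
      (volume.real (Metric.ball (0 : E d) 1) ^ (1 / (d : ℝ)) * k * C * (2 * k) ^ d /
        volume.real (Metric.ball (0 : E d) 1)) * volume.real T'.carrier := by
  have hw := volume_real_unitBall_pos (d := d)
  have h1 := T.meshSize_le hd
  have h2 := diam_le_of_mem_elementsAt hd hk0.le hk hT
  have h3 := le_volume_of_mem_elementsAt hd hk0 hk hT'
  obtain ⟨-, i, rfl⟩ := mem_elementsAt.1 hT
  set w := volume.real (Metric.ball (0 : E d) 1)
  set D := Metric.diam (T.side i)
  have hD0 : 0 ≤ D := Metric.diam_nonneg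
  have h4 : μHE[d - 1].real (T.side i) ≤ C * D ^ (d - 1) :=
    ENNReal.toReal_le_of_le_ofReal (by positivity) (hC T i)
  have hpow : D * D ^ (d - 1) = D ^ d := by
    rw [← pow_succ', Nat.sub_add_cancel (by omega)]
  calc T.meshSize * μHE[d - 1].real (T.side i)
      ≤ (w ^ (1 / (d : ℝ)) * (k * D)) * (C * D ^ (d - 1)) := by
        refine mul_le_mul (h1.trans (by gcongr)) h4 measureReal_nonneg (by positivity)
    _ = w ^ (1 / (d : ℝ)) * k * C * (D * D ^ (d - 1)) := by ring
    _ = (w ^ (1 / (d : ℝ)) * k * C * (2 * k) ^ d / w) * ((D / (2 * k)) ^ d * w) := by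
        rw [hpow, div_pow]
        field_simp
    _ ≤ _ := by gcongr

/-- Double counting: an element `T'` has `d + 1` sides, each shared by at most `N` elements `T`,
with at most `d + 1` indices `i` apiece. -/
theorem sum_sum_elementsAt_le {x : TaggedSimplex d → ℝ} (hx : ∀ T, 0 ≤ x T) {N : ℝ}
    (hN : ∀ S, ((elementsAt 𝒯 S).card : ℝ) ≤ N) :
    ∑ T ∈ 𝒯, ∑ i, ∑ T' ∈ elementsAt 𝒯 (T.side i), x T' ≤ (d + 1) ^ 2 * N * ∑ T ∈ 𝒯, x T := by
  classical
  calc ∑ T ∈ 𝒯, ∑ i, ∑ T' ∈ elementsAt 𝒯 (T.side i), x T'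
      ≤ ∑ T ∈ 𝒯, ∑ i, ∑ T' ∈ 𝒯, ∑ j, if T'.side j = T.side i then x T' else 0 := by
        gcongr with T hT i
        rw [elementsAt, Finset.sum_filter]
        gcongr with T' hT'
        split_ifs with h
        · obtain ⟨j, hj⟩ := h
          refine le_trans ?_ (Finset.single_le_sum (fun j _ => ?_) (Finset.mem_univ j))
          · rw [if_pos hj]
          · split_ifs <;> simp [hx]
        · exact Finset.sum_nonneg fun j _ => by split_ifs <;> simp [hx]
    _ = ∑ T' ∈ 𝒯, ∑ j, ∑ T ∈ 𝒯, ∑ i, if T'.side j = T.side i then x T' else 0 := by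
        rw [Finset.sum_congr rfl fun T _ => Finset.sum_comm, Finset.sum_comm]
        refine Finset.sum_congr rfl fun T' _ => ?_
        rw [Finset.sum_congr rfl fun T _ => Finset.sum_comm, Finset.sum_comm]
    _ ≤ ∑ T' ∈ 𝒯, ∑ j : Fin (d + 1), ((d + 1) * N) * x T' := by
        gcongr with T' hT' j
        calc ∑ T ∈ 𝒯, ∑ i, (if T'.side j = T.side i then x T' else 0)
            ≤ ∑ T ∈ 𝒯, if ∃ i, T.side i = T'.side j then (d + 1) * x T' else 0 := by
              gcongr with T hT
              split_ifs with h
              · refine (Finset.sum_le_card_nsmul _ _ (x T') fun i _ => ?_).trans (by simp)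
                split_ifs <;> simp [hx]
              · push Not at h
                simp [fun i => (h i).symm]
          _ = (elementsAt 𝒯 (T'.side j)).card * ((d + 1) * x T') := by
              rw [← Finset.sum_filter, Finset.sum_const, nsmul_eq_mul]
              congr!
          _ ≤ N * ((d + 1) * x T') := by
              have := hx T'
              gcongr
              exact hN _
          _ = _ := by ring
    _ = _ := by
        simp only [Finset.sum_const, Finset.card_univ, Fintype.card_fin, nsmul_eq_mul,
          ← Finset.mul_sum]
        push_cast
        ring

end Patches

/-! ### The Lipschitz property of the residuals -/

section ResidualLipschitz

variable {d : ℕ} [NeZero d] {Ω : Set (E d)} {α : E d → ℝ → ℝ} {ca Ca Λ k : ℝ} {𝒯 : Mesh d}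

omit [NeZero d] in
theorem meshSize_le_of_mem (hΩb : Bornology.IsBounded Ω) (h𝒯 : IsConformingTriangulation Ω 𝒯)
    {T : TaggedSimplex d} (hT : T ∈ 𝒯) :
    T.meshSize ≤ volume.real (closure Ω) ^ (1 / (d : ℝ)) :=
  Real.rpow_le_rpow measureReal_nonneg
    (measureReal_mono (h𝒯.carrier_subset hT) hΩb.isCompact_closure.measure_lt_top.ne)
    (by positivity)

theorem integral_jumpResidual_sub_sq_le (hα : IsAdmissibleCoeff Ω α ca Ca) (hca : 0 < ca)
    (hCa : 0 ≤ Ca) (hΛ : IsPiecewiseLipschitz 𝒯 α Λ) (hTΩ : ∀ T ∈ 𝒯, interior T.carrier ⊆ Ω)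
    (V W : L2Pair Ω) {N : ℝ} {S : Set (E d)} (hN : ((elementsAt 𝒯 S).card : ℝ) ≤ N)
    (hS : μHE[d - 1] S < ⊤) :
    ∫ x in S, (jumpResidual Ω α 𝒯 V S x - jumpResidual Ω α 𝒯 W S x) ^ 2 ∂μHE[d - 1] ≤
      μHE[d - 1].real S * (((d + 1) * Ca) ^ 2 * N *
        ∑ T ∈ elementsAt 𝒯 S, ‖elemGrad Ω V T - elemGrad Ω W T‖ ^ 2) := by
  have h := norm_setIntegral_le_of_norm_le_const (μ := μHE[d - 1]) (s := S)
    (f := fun x => (jumpResidual Ω α 𝒯 V S x - jumpResidual Ω α 𝒯 W S x) ^ 2)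
    (C := ((d + 1) * Ca) ^ 2 * N *
        ∑ T ∈ elementsAt 𝒯 S, ‖elemGrad Ω V T - elemGrad Ω W T‖ ^ 2) hS (fun x hx => by
      rw [norm_pow, Real.norm_eq_abs]
      refine (pow_le_pow_left₀ (abs_nonneg _)
        (abs_jumpResidual_sub_le hα hca hΛ hTΩ V W hx hCa) 2).trans ?_
      rw [mul_pow, mul_assoc]
      gcongr
      exact sq_sum_le_card_mul_sum_sq.trans (by gcongr))
  rw [mul_comm]
  exact (le_abs_self _).trans h

/-- The Lipschitz constant of the residuals on shape regular meshes; `C` bounds the measures of the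
sides and `k` is the shape regularity constant. -/
def residualConst {d : ℕ} (Ω : Set (E d)) (Ca Λ C k : ℝ) : ℝ :=
  2 * ((volume.real (closure Ω) ^ (1 / (d : ℝ))) ^ 2 * (d * (3 * Λ)) ^ 2) +
    2 * (((d + 1) * Ca) ^ 2 * (2 * k ^ 2) ^ d *
      (volume.real (Metric.ball (0 : E d) 1) ^ (1 / (d : ℝ)) * k * C * (2 * k) ^ d /
        volume.real (Metric.ball (0 : E d) 1)) * ((d + 1) ^ 2 * (2 * k ^ 2) ^ d))

/-- In the element term `H_T` is bounded by the size of `Ω`. In the jump term `H_T` and the measure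
of the side together are absorbed into the volumes of the neighbours, leaving a sum of local
gradient norms. -/
theorem sum_residualDiff_sq_le (hd : 2 ≤ d) (hΩb : Bornology.IsBounded Ω)
    (hΩ : interior (closure Ω) = Ω) (hα : IsAdmissibleCoeff Ω α ca Ca) (hca : 0 < ca)
    (hCa : 0 ≤ Ca) (hΛ : IsPiecewiseLipschitz 𝒯 α Λ) (hΛ0 : 0 ≤ Λ) (hk0 : 0 < k)
    (hk : ∀ T ∈ 𝒯, Metric.diam T.carrier ≤ k * T.inradius)
    (h𝒯 : IsConformingTriangulation Ω 𝒯) {C : ℝ} (hC0 : 0 ≤ C)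
    (hC : ∀ (T : TaggedSimplex d) (i : Fin (d + 1)), μHE[d - 1] (T.side i) ≤
      ENNReal.ofReal (C * Metric.diam (T.side i) ^ (d - 1)))
    (f : Lp ℝ 2 (vol Ω)) {V W : L2Pair Ω} (hV : V ∈ feSpace Ω 𝒯) (hW : W ∈ feSpace Ω 𝒯) :
    ∑ T ∈ 𝒯, residualDiff Ω α f 𝒯 V W T ^ 2 ≤
      residualConst Ω Ca Λ C k * ‖(V - W).2‖ ^ 2 := by
  rw [residualConst]
  set H := volume.real (closure Ω) ^ (1 / (d : ℝ))
  set N := (2 * k ^ 2) ^ d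
  set M := volume.real (Metric.ball (0 : E d) 1) ^ (1 / (d : ℝ)) * k * C * (2 * k) ^ d /
            volume.real (Metric.ball (0 : E d) 1)
  have hN0 : 0 ≤ N := by positivity
  have hM0 : 0 ≤ M := by positivity
  set x : TaggedSimplex d → ℝ := fun T =>
    volume.real T.carrier * ‖elemGrad Ω V T - elemGrad Ω W T‖ ^ 2 with hx
  have hx0 : ∀ T, 0 ≤ x T := fun T => by positivity
  have hTΩ : ∀ T ∈ 𝒯, interior T.carrier ⊆ Ω := fun T hT => h𝒯.interior_subset hΩ hT
  have hNc := card_elementsAt_le hd hk0 hk h𝒯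
  have hT : ∀ T ∈ 𝒯, residualDiff Ω α f 𝒯 V W T ^ 2 ≤ 2 * (H ^ 2 * (d * (3 * Λ)) ^ 2 * x T) +
      2 * (((d + 1) * Ca) ^ 2 * N * M * ∑ i, ∑ T' ∈ elementsAt 𝒯 (T.side i), x T') := by
    intro T hT
    have hR := integral_elemResidual_sub_sq_le hα hΛ hΛ0 hT (hTΩ T hT) f V W
    have hJ : T.meshSize * ∑ i : Fin (d + 1), ∫ x in T.side i,
        (jumpResidual Ω α 𝒯 V (T.side i) x - jumpResidual Ω α 𝒯 W (T.side i) x) ^ 2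
          ∂μHE[d - 1] ≤
        ((d + 1) * Ca) ^ 2 * N * M * ∑ i, ∑ T' ∈ elementsAt 𝒯 (T.side i), x T' := by
      rw [Finset.mul_sum, Finset.mul_sum]
      refine Finset.sum_le_sum fun i _ => ?_
      have hTi : T ∈ elementsAt 𝒯 (T.side i) := mem_elementsAt.2 ⟨hT, i, rfl⟩
      refine (mul_le_mul_of_nonneg_left (integral_jumpResidual_sub_sq_le hα hca hCa hΛ hTΩ V W
        (hNc (T.side i)) ((hC T i).trans_lt ENNReal.ofReal_lt_top)) T.meshSize_nonneg).trans ?_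
      calc T.meshSize * (μHE[d - 1].real (T.side i) * (((d + 1) * Ca) ^ 2 * N *
            ∑ T' ∈ elementsAt 𝒯 (T.side i), ‖elemGrad Ω V T' - elemGrad Ω W T'‖ ^ 2))
          = ((d + 1) * Ca) ^ 2 * N * ∑ T' ∈ elementsAt 𝒯 (T.side i),
            (T.meshSize * μHE[d - 1].real (T.side i)) *
              ‖elemGrad Ω V T' - elemGrad Ω W T'‖ ^ 2 := by
            rw [← Finset.mul_sum]
            ring
        _ ≤ ((d + 1) * Ca) ^ 2 * N * ∑ T' ∈ elementsAt 𝒯 (T.side i), M * x T' := by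
            refine mul_le_mul_of_nonneg_left (Finset.sum_le_sum fun T' hT' => ?_) (by positivity)
            refine le_trans ?_ (mul_assoc M _ _).le
            exact mul_le_mul_of_nonneg_right (meshSize_mul_measure_le hd hk0 hk hC0 hC hTi hT')
              (sq_nonneg _)
        _ = _ := by
            rw [← Finset.mul_sum]
            ring
    have hm := meshSize_le_of_mem hΩb h𝒯 hT
    have hR' : T.meshSize ^ 2 * ∫ x in T.carrier,
        (elemResidual Ω α f V T x - elemResidual Ω α f W T x) ^ 2 ≤
        H ^ 2 * (d * (3 * Λ)) ^ 2 * x T := by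
      rw [mul_assoc]
      have := T.meshSize_nonneg
      gcongr
    rw [residualDiff]
    refine add_sq_le.trans ?_
    rw [mul_pow, mul_pow, Real.sq_sqrt (integral_nonneg fun x => sq_nonneg _),
      Real.sq_sqrt T.meshSize_nonneg, Real.sq_sqrt (Finset.sum_nonneg fun i _ =>
        integral_nonneg fun x => sq_nonneg _), mul_add]
    gcongr
  have hsum : ∑ T ∈ 𝒯, x T ≤ ‖(V - W).2‖ ^ 2 :=
    sum_volume_mul_norm_elemGrad_sub_le hΩ h𝒯 (fun T _ => T.volume_carrier_ne_zero) hV hW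
  calc ∑ T ∈ 𝒯, residualDiff Ω α f 𝒯 V W T ^ 2
      ≤ 2 * (H ^ 2 * (d * (3 * Λ)) ^ 2 * ∑ T ∈ 𝒯, x T) + 2 * (((d + 1) * Ca) ^ 2 * N * M *
        ∑ T ∈ 𝒯, ∑ i, ∑ T' ∈ elementsAt 𝒯 (T.side i), x T') := by
        refine (Finset.sum_le_sum hT).trans (le_of_eq ?_)
        simp only [Finset.sum_add_distrib, ← Finset.mul_sum]
    _ ≤ 2 * (H ^ 2 * (d * (3 * Λ)) ^ 2 * ∑ T ∈ 𝒯, x T) + 2 * (((d + 1) * Ca) ^ 2 * N * M *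
        ((d + 1) ^ 2 * N * ∑ T ∈ 𝒯, x T)) := by
        gcongr
        exact sum_sum_elementsAt_le hx0 hNc
    _ = (2 * (H ^ 2 * (d * (3 * Λ)) ^ 2) + 2 * (((d + 1) * Ca) ^ 2 * N * M *
        ((d + 1) ^ 2 * N))) * ∑ T ∈ 𝒯, x T := by ring
    _ ≤ _ := by gcongr

end ResidualLipschitz

/-! ### Perturbation of the oscillation -/

section Oscillation

/-- Expanding the square shows that the two sides differ by `μ(X) m²`, with `m` the mean. -/
theorem integral_sub_average_sq_le {X : Type*} [MeasurableSpace X] {μ : Measure X}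
    [IsFiniteMeasure μ] {h : X → ℝ} (hh : MemLp h 2 μ) :
    ∫ x, (h x - ⨍ y, h y ∂μ) ^ 2 ∂μ ≤ ∫ x, h x ^ 2 ∂μ := by
  have h1 := hh.integrable one_le_two
  have h2 := hh.integrable_sq
  set m := ⨍ y, h y ∂μ with hm
  have h3 : ∫ x, h x ∂μ = μ.real univ * m := by
    rw [hm, ← smul_eq_mul, measure_smul_average]
  have e : ∀ x, (h x - m) ^ 2 = h x ^ 2 - (2 * m * h x - m ^ 2) := fun x => by ring
  have e1 : ∫ x, (2 * m * h x - m ^ 2) ∂μ = 2 * m * (μ.real univ * m) - μ.real univ * m ^ 2 := by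
    rw [integral_sub (h1.const_mul _) (integrable_const _), integral_const_mul, h3, integral_const,
      smul_eq_mul]
  have h4 : Integrable (fun x => 2 * m * h x - m ^ 2) μ :=
    (h1.const_mul _).sub (integrable_const _)
  simp only [e]
  rw [integral_sub h2 h4, e1]
  nlinarith [mul_nonneg (measureReal_nonneg (μ := μ) (s := univ)) (sq_nonneg m)]

theorem integral_sub_average_sq_le_add {X : Type*} [MeasurableSpace X] {μ : Measure X}
    [IsFiniteMeasure μ] {g h : X → ℝ} (hg : MemLp g 2 μ) (hh : MemLp h 2 μ) :
    ∫ x, (g x - ⨍ y, g y ∂μ) ^ 2 ∂μ ≤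
      2 * ∫ x, (h x - ⨍ y, h y ∂μ) ^ 2 ∂μ + 2 * ∫ x, (g x - h x) ^ 2 ∂μ := by
  have hs := hg.sub hh
  have hav : ⨍ y, (g - h) y ∂μ = (⨍ y, g y ∂μ) - ⨍ y, h y ∂μ := by
    simp only [average_eq, Pi.sub_apply]
    rw [integral_sub (hg.integrable one_le_two) (hh.integrable one_le_two), smul_sub]
  have i1 : ∀ {u : X → ℝ}, MemLp u 2 μ → ∀ c, Integrable (fun x => (u x - c) ^ 2) μ :=
    fun hu c => (hu.sub (memLp_const c)).integrable_sq
  calc ∫ x, (g x - ⨍ y, g y ∂μ) ^ 2 ∂μ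
      ≤ ∫ x, (2 * (h x - ⨍ y, h y ∂μ) ^ 2 + 2 * ((g - h) x - ⨍ y, (g - h) y ∂μ) ^ 2) ∂μ := by
        refine integral_mono (i1 hg _) (((i1 hh _).const_mul 2).add ((i1 hs _).const_mul 2)) ?_
        intro x
        simp only [hav]
        simp only [Pi.sub_apply]
        nlinarith [sq_nonneg ((h x - ⨍ y, h y ∂μ) -
          (g x - h x - ((⨍ y, g y ∂μ) - ⨍ y, h y ∂μ)))]
    _ = 2 * ∫ x, (h x - ⨍ y, h y ∂μ) ^ 2 ∂μ +
        2 * ∫ x, ((g - h) x - ⨍ y, (g - h) y ∂μ) ^ 2 ∂μ := by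
        rw [integral_add ((i1 hh _).const_mul 2) ((i1 hs _).const_mul 2), integral_const_mul,
          integral_const_mul]
    _ ≤ _ := by
        exact add_le_add le_rfl
          (mul_le_mul_of_nonneg_left (integral_sub_average_sq_le hs) zero_le_two)

variable {d : ℕ} [NeZero d] {Ω : Set (E d)} {α : E d → ℝ → ℝ} {ca Ca Λ : ℝ} {𝒯 : Mesh d}

theorem oscSq_nonneg (f : Lp ℝ 2 (vol Ω)) (V : L2Pair Ω) : 0 ≤ oscSq Ω α f 𝒯 V := by
  refine Finset.sum_nonneg fun T _ => add_nonneg (mul_nonneg (sq_nonneg _) ?_)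
    (mul_nonneg T.meshSize_nonneg (Finset.sum_nonneg fun i _ => ?_))
  · exact integral_nonneg fun x => sq_nonneg _
  · exact integral_nonneg fun x => sq_nonneg _

/-- On each element and each side the residual of `U` is that of `V` plus a difference, and removing
the mean from the difference only decreases its norm. -/
theorem oscSq_le (hα : IsAdmissibleCoeff Ω α ca Ca) (hΛ : IsPiecewiseLipschitz 𝒯 α Λ)
    (hΛ0 : 0 ≤ Λ) (hTΩ : ∀ T ∈ 𝒯, interior T.carrier ⊆ Ω)
    (hS : ∀ (T : TaggedSimplex d) (i : Fin (d + 1)), μHE[d - 1] (T.side i) < ⊤)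
    (f : Lp ℝ 2 (vol Ω)) (U V : L2Pair Ω) :
    oscSq Ω α f 𝒯 U ≤ 2 * oscSq Ω α f 𝒯 V + 2 * ∑ T ∈ 𝒯, residualDiff Ω α f 𝒯 U V T ^ 2 := by
  rw [oscSq, oscSq, Finset.mul_sum, Finset.mul_sum, ← Finset.sum_add_distrib]
  refine Finset.sum_le_sum fun T hT => ?_
  have hR : ∫ x in T.carrier, (elemResidual Ω α f U T x -
        ⨍ y in T.carrier, elemResidual Ω α f U T y) ^ 2 ≤
      2 * (∫ x in T.carrier, (elemResidual Ω α f V T x -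
        ⨍ y in T.carrier, elemResidual Ω α f V T y) ^ 2) +
      2 * ∫ x in T.carrier, (elemResidual Ω α f U T x - elemResidual Ω α f V T x) ^ 2 := by
    have : IsFiniteMeasure (volume.restrict T.carrier) := ⟨by simpa using T.volume_carrier_lt_top⟩
    exact integral_sub_average_sq_le_add (memLp_elemResidual hα hΛ hΛ0 hT (hTΩ T hT) f U)
      (memLp_elemResidual hα hΛ hΛ0 hT (hTΩ T hT) f V)
  have hJ : ∑ i : Fin (d + 1), ∫ x in T.side i, (jumpResidual Ω α 𝒯 U (T.side i) x -
        ⨍ y in T.side i, jumpResidual Ω α 𝒯 U (T.side i) y ∂μHE[d - 1]) ^ 2 ∂μHE[d - 1] ≤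
      2 * (∑ i : Fin (d + 1), ∫ x in T.side i, (jumpResidual Ω α 𝒯 V (T.side i) x -
        ⨍ y in T.side i, jumpResidual Ω α 𝒯 V (T.side i) y ∂μHE[d - 1]) ^ 2 ∂μHE[d - 1]) +
      2 * ∑ i : Fin (d + 1), ∫ x in T.side i,
        (jumpResidual Ω α 𝒯 U (T.side i) x - jumpResidual Ω α 𝒯 V (T.side i) x) ^ 2
          ∂μHE[d - 1] := by
    rw [Finset.mul_sum, Finset.mul_sum, ← Finset.sum_add_distrib]
    refine Finset.sum_le_sum fun i _ => ?_
    have : IsFiniteMeasure (μHE[d - 1].restrict (T.side i)) := ⟨by simpa using hS T i⟩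
    have hm : ∀ V : L2Pair Ω, MemLp (jumpResidual Ω α 𝒯 V (T.side i)) 2
        (μHE[d - 1].restrict (T.side i)) := fun V => by
      have hc := continuousOn_jumpResidual hα hΛ hTΩ V (T.side i)
      have hcomp := T.isCompact_side i
      obtain ⟨B, hB⟩ := hcomp.exists_bound_of_continuousOn hc
      refine MemLp.of_bound (hc.aestronglyMeasurable hcomp.measurableSet) B ?_
      filter_upwards [ae_restrict_mem hcomp.measurableSet] with x hx using hB x hx
    exact integral_sub_average_sq_le_add (hm U) (hm V)
  have hg : T.meshSize ^ 2 * (∫ x in T.carrier,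
        (elemResidual Ω α f U T x - elemResidual Ω α f V T x) ^ 2) +
      T.meshSize * (∑ i : Fin (d + 1), ∫ x in T.side i,
        (jumpResidual Ω α 𝒯 U (T.side i) x - jumpResidual Ω α 𝒯 V (T.side i) x) ^ 2
          ∂μHE[d - 1]) ≤ residualDiff Ω α f 𝒯 U V T ^ 2 := by
    have e1 := Real.sq_sqrt (integral_nonneg (μ := volume.restrict T.carrier) fun x =>
      sq_nonneg (elemResidual Ω α f U T x - elemResidual Ω α f V T x))
    have e2 := Real.sq_sqrt (Finset.sum_nonneg fun i (_ : i ∈ Finset.univ) =>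
      integral_nonneg (μ := μHE[d - 1].restrict (T.side i)) fun x =>
        sq_nonneg (jumpResidual Ω α 𝒯 U (T.side i) x - jumpResidual Ω α 𝒯 V (T.side i) x))
    have e3 := Real.sq_sqrt T.meshSize_nonneg
    rw [residualDiff, add_sq, mul_pow, mul_pow]
    simp only at e1 e2
    rw [e1, e2, e3]
    have : 0 ≤ 2 * (T.meshSize * √(∫ x in T.carrier,
        (elemResidual Ω α f U T x - elemResidual Ω α f V T x) ^ 2)) *
        (√T.meshSize * √(∑ i : Fin (d + 1), ∫ x in T.side i,
        (jumpResidual Ω α 𝒯 U (T.side i) x - jumpResidual Ω α 𝒯 V (T.side i) x) ^ 2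
          ∂μHE[d - 1])) := by
      have := T.meshSize_nonneg
      positivity
    linarith
  have h1 := mul_le_mul_of_nonneg_left hR (sq_nonneg T.meshSize)
  have h2 := mul_le_mul_of_nonneg_left hJ T.meshSize_nonneg
  rw [localOscSq, localOscSq]
  linarith

end Oscillation

/-! ### Shape regularity of bisection -/

section Bisection

variable {d : ℕ}

theorem TaggedSimplex.vertex_eq (T : TaggedSimplex d) (i : Fin (d + 1)) :
    T.vertex i = T.simplex.points i := by
  rw [vertex]
  congr 1
  exact Fin.ext (Nat.mod_eq_of_lt i.2)

theorem TaggedSimplex.vertex_mem_carrier (T : TaggedSimplex d) (k : ℕ) : T.vertex k ∈ T.carrier :=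
  subset_convexHull ℝ _ (mem_range_self _)

theorem TaggedSimplex.IsBisection.carrier_subset [NeZero d] {T T₁ T₂ : TaggedSimplex d}
    (h : T.IsBisection T₁ T₂) : T₁.carrier ⊆ T.carrier ∧ T₂.carrier ⊆ T.carrier := by
  have hm : midpoint ℝ (T.vertex 0) (T.vertex d) ∈ T.carrier :=
    T.convex_carrier.midpoint_mem (T.vertex_mem_carrier 0) (T.vertex_mem_carrier d)
  constructor <;> refine convexHull_min ?_ T.convex_carrier <;> rintro _ ⟨i, rfl⟩
  · rw [h.2.2.1 i]
    split_ifs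
    · exact T.vertex_mem_carrier _
    · exact hm
    · exact T.vertex_mem_carrier _
  · rw [h.2.2.2 i]
    split_ifs
    · exact T.vertex_mem_carrier _
    · exact hm
    · exact T.vertex_mem_carrier _
    · exact T.vertex_mem_carrier _

/-- Intermediate meshes need not be conforming, so the induction concerns properties of single
simplices. -/
theorem forall_mem_of_reflTransGen [NeZero d] {p : TaggedSimplex d → Prop} {𝒯₀ 𝒯 : Mesh d}
    (h : Relation.ReflTransGen BisectStep 𝒯₀ 𝒯) (h0 : ∀ T ∈ 𝒯₀, p T)
    (hp : ∀ T T₁ T₂ : TaggedSimplex d, T.IsBisection T₁ T₂ → p T → p T₁ ∧ p T₂) :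
    ∀ T ∈ 𝒯, p T := by
  induction h with
  | refl => exact h0
  | tail _ hs ih =>
    obtain ⟨T, hT, T₁, T₂, hb, hK⟩ := hs
    intro K hK'
    rcases (hK K).1 hK' with ⟨hK1, -⟩ | rfl | rfl
    · exact ih K hK1
    · exact (hp T _ _ hb (ih T hT)).1
    · exact (hp T _ _ hb (ih T hT)).2

/-- Every element lies in an initial one. The absolute value supplies the nonnegative constant
required later. -/
theorem IsPiecewiseLipschitz.of_mem_meshFamily [NeZero d] {Ω : Set (E d)} {𝒯₀ 𝒯 : Mesh d}
    {α : E d → ℝ → ℝ} {Λ : ℝ} (hΛ : IsPiecewiseLipschitz 𝒯₀ α Λ) (h𝒯 : 𝒯 ∈ meshFamily Ω 𝒯₀) :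
    IsPiecewiseLipschitz 𝒯 α |Λ| := by
  have h := forall_mem_of_reflTransGen (p := fun T => ∃ T₀ ∈ 𝒯₀, T.carrier ⊆ T₀.carrier) h𝒯.1
    (fun T hT => ⟨T, hT, Subset.rfl⟩) (by
      rintro T T₁ T₂ hb ⟨T₀, hT₀, hT⟩
      exact ⟨⟨T₀, hT₀, hb.carrier_subset.1.trans hT⟩, ⟨T₀, hT₀, hb.carrier_subset.2.trans hT⟩⟩)
  intro T hT x hx y hy t ht
  obtain ⟨T₀, hT₀, hsub⟩ := h T hT
  obtain ⟨h1, h2⟩ := hΛ T₀ hT₀ x (interior_mono hsub hx) y (interior_mono hsub hy) t ht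
  have h3 : Λ * ‖x - y‖ ≤ |Λ| * ‖x - y‖ :=
    mul_le_mul_of_nonneg_right (le_abs_self _) (norm_nonneg _)
  exact ⟨h1.trans h3, h2.trans h3⟩

/-- The vertices of the reference simplex of type `γ`, where the sequence `P` of vertices of a
Kuhn simplex describes the reference simplex of type `0`. -/
def refVertex (d γ : ℕ) (P : ℕ → E d) (i : ℕ) : E d :=
  if i = 0 then 0 else if i ≤ γ then (1 / 2 : ℝ) • P (d - γ + i) else P (i - γ)

/-- The points `y` are, up to a homothety, the vertices of a reference simplex of type `γ` with
edge vectors in `B`. -/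
def HasRefShape (B : Set (E d)) (γ : ℕ) (y : ℕ → E d) : Prop :=
  ∃ (s : ℝ) (c : E d) (P : ℕ → E d), 0 < s ∧ P 0 = 0 ∧ (∀ n < d, P (n + 1) - P n ∈ B) ∧
    ∀ i ≤ d, y i = c + s • refVertex d γ P i

/-- In type `d` every vertex carries the factor `1/2`, which is absorbed into the scale; this closes
the cycle of types. -/
theorem HasRefShape.zero_of_eq {B : Set (E d)} {y : ℕ → E d} (h : HasRefShape B d y) :
    HasRefShape B 0 y := by
  obtain ⟨s, c, P, hs, hP0, hP, hy⟩ := h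
  refine ⟨s / 2, c, P, by positivity, hP0, hP, fun i hi => ?_⟩
  rw [hy i hi, refVertex, refVertex]
  rcases Nat.eq_zero_or_pos i with rfl | hi0
  · simp
  · rw [if_neg hi0.ne', if_neg hi0.ne', if_pos hi, if_neg (by omega), Nat.sub_self, zero_add,
      Nat.sub_zero, smul_smul]
    congr 2
    ring

/-- Path and scale are unchanged: the new vertex `P (d - γ) / 2` is exactly the first vertex after
the origin in the reference simplex of type `γ + 1`. -/
theorem HasRefShape.left {B : Set (E d)} {γ : ℕ} (hγ : γ < d) {y z : ℕ → E d}
    (h : HasRefShape B γ y) (hz0 : z 0 = y 0) (hz1 : z 1 = midpoint ℝ (y 0) (y d))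
    (hz : ∀ i, 2 ≤ i → i ≤ d → z i = y (i - 1)) : HasRefShape B (γ + 1) z := by
  obtain ⟨s, c, P, hs, hP0, hP, hy⟩ := h
  refine ⟨s, c, P, hs, hP0, hP, fun i hi => ?_⟩
  rcases (by omega : i = 0 ∨ i = 1 ∨ 2 ≤ i) with rfl | rfl | hi2
  · rw [hz0, hy 0 (Nat.zero_le _), refVertex, refVertex, if_pos rfl, if_pos rfl]
  · rw [hz1, hy 0 (Nat.zero_le _), hy d le_rfl, midpoint_eq_smul_add]
    simp only [refVertex, if_pos, if_neg (by omega : ¬ d = 0), if_neg (by omega : ¬ d ≤ γ),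
      if_neg one_ne_zero, if_pos (by omega : 1 ≤ γ + 1), (by omega : d - (γ + 1) + 1 = d - γ)]
    simp only [invOf_eq_inv]
    module
  · rw [hz i hi2 hi, hy _ (by omega)]
    congr 2
    rw [refVertex, refVertex, if_neg (by omega : ¬ i - 1 = 0), if_neg (by omega : ¬ i = 0)]
    by_cases hig : i ≤ γ + 1
    · rw [if_pos (by omega : i - 1 ≤ γ), if_pos hig]
      congr 2
      omega
    · rw [if_neg (by omega : ¬ i - 1 ≤ γ), if_neg hig]
      congr 1
      omega

/-- With the origin moved to `y d`, which corresponds to `P m` for `m = d - γ`, the new path runs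
back from `P m` to `0` and then follows the remaining original edges. The reversed edges are the
reason for requiring `B` to be symmetric. -/
theorem HasRefShape.right {B : Set (E d)} (hB : ∀ b ∈ B, -b ∈ B) {γ : ℕ} (hγ : γ < d)
    {y z : ℕ → E d} (h : HasRefShape B γ y) (hz0 : z 0 = y d)
    (hz1 : z 1 = midpoint ℝ (y 0) (y d)) (hz : ∀ i, 2 ≤ i → i ≤ γ + 1 → z i = y (i - 1))
    (hz' : ∀ i, γ + 2 ≤ i → i ≤ d → z i = y (d + γ + 1 - i)) : HasRefShape B (γ + 1) z := by
  obtain ⟨s, c, P, hs, hP0, hP, hy⟩ := h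
  set m := d - γ with hm
  refine ⟨s, y d, fun n => if n ≤ m then P (m - n) - P m else P n - P m - P m, hs, by simp,
    fun n hn => ?_, fun i hi => ?_⟩
  · by_cases hnm : n + 1 ≤ m
    · simp only [if_pos hnm, if_pos (by omega : n ≤ m)]
      have := hB _ (hP (m - (n + 1)) (by omega))
      rw [(by omega : m - (n + 1) + 1 = m - n)] at this
      convert this using 1
      abel
    · simp only [if_neg hnm]
      have := hP n hn
      by_cases hnm' : n ≤ m
      · obtain rfl : n = m := by omega
        simp only [le_refl, if_true, Nat.sub_self, hP0]
        convert this using 1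
        abel
      · simp only [if_neg hnm']
        convert this using 1
        abel
  · have hyd : y d = c + s • P m := by
      rw [hy d le_rfl, refVertex, if_neg (by omega), if_neg (by omega)]
    rcases (by omega : i = 0 ∨ i = 1 ∨ 2 ≤ i) with rfl | rfl | hi2
    · rw [hz0, refVertex, if_pos rfl, smul_zero, add_zero]
    · rw [hz1, hy 0 (Nat.zero_le _), hyd, midpoint_eq_smul_add]
      simp only [refVertex, if_pos, if_neg one_ne_zero, if_pos (by omega : 1 ≤ γ + 1),
        if_pos (by omega : d - (γ + 1) + 1 ≤ m), (by omega : m - (d - (γ + 1) + 1) = 0), hP0]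
      simp only [invOf_eq_inv]
      module
    · by_cases hig : i ≤ γ + 1
      · rw [hz i hi2 hig, hy _ (by omega), hyd]
        simp only [refVertex, if_neg (by omega : ¬ i = 0), if_pos hig,
          if_neg (by omega : ¬ i - 1 = 0), if_pos (by omega : i - 1 ≤ γ),
          if_neg (by omega : ¬ d - γ + (i - 1) ≤ m),
          (by omega : d - (γ + 1) + i = d - γ + (i - 1))]
        module
      · rw [hz' i (by omega) hi, hy _ (by omega), hyd]
        simp only [refVertex, if_neg (by omega : ¬ i = 0), if_neg hig,
          if_neg (by omega : ¬ d + γ + 1 - i = 0), if_neg (by omega : ¬ d + γ + 1 - i ≤ γ),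
          if_pos (by omega : i - (γ + 1) ≤ m),
          (by omega : m - (i - (γ + 1)) = d + γ + 1 - i - γ)]
        module

theorem TaggedSimplex.IsBisection.hasRefShape [NeZero d] {B : Set (E d)} (hB : ∀ b ∈ B, -b ∈ B)
    {T T₁ T₂ : TaggedSimplex d} (h : T.IsBisection T₁ T₂) (hT : HasRefShape B T.tag T.vertex) :
    HasRefShape B T₁.tag T₁.vertex ∧ HasRefShape B T₂.tag T₂.vertex := by
  obtain ⟨ht₁, ht₂, h₁, h₂⟩ := h
  have hd0 : 0 < d := Nat.pos_of_ne_zero (NeZero.ne d)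
  have hv : ∀ (K : TaggedSimplex d) (k : ℕ) (hk : k ≤ d),
      K.vertex k = K.simplex.points ⟨k, by omega⟩ := fun K k hk => K.vertex_eq ⟨k, by omega⟩
  -- The type is computed modulo `d`, so `T.tag + 1 = d` wraps around to `0`.
  have key : ∀ z, HasRefShape B (T.tag + 1) z → HasRefShape B (T.tag + 1 : Fin d) z := by
    intro z hz
    rw [Fin.val_add, Fin.val_one', Nat.add_mod_mod]
    rcases (by omega : (T.tag : ℕ) + 1 < d ∨ (T.tag : ℕ) + 1 = d) with hlt | heq
    · rwa [Nat.mod_eq_of_lt hlt]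
    · rw [heq] at hz ⊢
      rw [Nat.mod_self]
      exact hz.zero_of_eq
  rw [ht₁, ht₂]
  refine ⟨key _ (hT.left T.tag.2 ?_ ?_ fun i hi hid => ?_),
    key _ (hT.right hB T.tag.2 ?_ ?_ (fun i hi hig => ?_) fun i hi hid => ?_)⟩
  · rw [hv _ 0 (by omega), h₁, if_pos rfl]
  · rw [hv _ 1 hd0, h₁, if_neg one_ne_zero, if_pos rfl]
  · rw [hv _ i hid, h₁, if_neg (by simp; omega), if_neg (by simp; omega)]
  · rw [hv _ 0 (by omega), h₂, if_pos rfl]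
  · rw [hv _ 1 hd0, h₂, if_neg one_ne_zero, if_pos rfl]
  · have := T.tag.2
    rw [hv _ i (by omega), h₂, if_neg (by simp; omega), if_neg (by simp; omega), if_pos hig]
  · rw [hv _ i hid, h₂, if_neg (by simp; omega), if_neg (by simp; omega),
      if_neg (by simp; omega)]

/-- Any simplex fits the pattern once `P` is read off from its vertices. The three kinds of vectors
in `hB` are the steps before, after and at the index `d - γ`, where the scaling by `2` sets in. -/
theorem hasRefShape_of_forall {B : Set (E d)} {γ : ℕ} (hγ : γ < d) {y : ℕ → E d}
    (hB : ∀ i ≤ d, ∀ j ≤ d, y i - y j ∈ B ∧ (2 : ℝ) • (y i - y j) ∈ B ∧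
      (2 : ℝ) • (y i - y 0) - (y j - y 0) ∈ B) : HasRefShape B γ y := by
  refine ⟨1, y 0, fun n => if n = 0 then 0 else if n ≤ d - γ then y (n + γ) - y 0 else
    (2 : ℝ) • (y (n - (d - γ)) - y 0), one_pos, if_pos rfl, fun n hn => ?_, fun i hi => ?_⟩
  · simp only [if_neg (by omega : ¬ n + 1 = 0)]
    rcases Nat.eq_zero_or_pos n with rfl | hn0
    · rw [if_pos rfl, if_pos (by omega), sub_zero]
      exact (hB _ (by omega) _ (by omega)).1
    rw [if_neg hn0.ne']
    by_cases h1 : n + 1 ≤ d - γ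
    · rw [if_pos h1, if_pos (by omega), sub_sub_sub_cancel_right]
      exact (hB _ (by omega) _ (by omega)).1
    · rw [if_neg h1]
      by_cases h2 : n ≤ d - γ
      · rw [if_pos h2]
        exact (hB _ (by omega) _ (by omega)).2.2
      · rw [if_neg h2, ← smul_sub, sub_sub_sub_cancel_right]
        exact (hB _ (by omega) _ (by omega)).2.1
  · simp only [refVertex, one_smul]
    rcases Nat.eq_zero_or_pos i with rfl | hi0
    · simp
    rw [if_neg hi0.ne']
    by_cases hig : i ≤ γ
    · rw [if_pos hig, if_neg (by omega), if_neg (by omega), smul_smul, Nat.add_sub_cancel_left]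
      norm_num
    · rw [if_neg hig, if_neg (by omega), if_pos (by omega), Nat.sub_add_cancel (by omega)]
      abel

theorem exists_finite_partialSums {B : Set (E d)} (hB : B.Finite) (n : ℕ) :
    ∃ F : Set (E d), F.Finite ∧ ∀ P : ℕ → E d, P 0 = 0 → (∀ j < d, P (j + 1) - P j ∈ B) →
      n ≤ d → P n ∈ F := by
  induction n with
  | zero => exact ⟨{0}, finite_singleton 0, fun P hP _ _ => hP⟩
  | succ n ih =>
    obtain ⟨F, hF, h⟩ := ih
    refine ⟨image2 (· + ·) F B, hF.image2 _ hB, fun P hP0 hP hn => ?_⟩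
    exact ⟨P n, h P hP0 hP (by omega), _, hP n hn, add_sub_cancel _ _⟩

theorem exists_finite_refVertex {B : Set (E d)} (hB : B.Finite) :
    ∃ G : Set (E d), G.Finite ∧ ∀ P : ℕ → E d, P 0 = 0 → (∀ j < d, P (j + 1) - P j ∈ B) →
      ∀ γ < d, ∀ i ≤ d, refVertex d γ P i ∈ G := by
  choose F hF h using exists_finite_partialSums (d := d) hB
  have hFf : (⋃ n ∈ Iic d, F n).Finite := (finite_Iic d).biUnion fun n _ => hF n
  refine ⟨(⋃ n ∈ Iic d, F n) ∪ (fun x => (1 / 2 : ℝ) • x) '' ⋃ n ∈ Iic d, F n,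
    hFf.union (hFf.image _), fun P hP0 hP γ hγ i hi => ?_⟩
  have hmem : ∀ n ≤ d, P n ∈ ⋃ n ∈ Iic d, F n := fun n hn =>
    mem_iUnion₂.2 ⟨n, hn, h n P hP0 hP hn⟩
  rw [refVertex]
  split_ifs with h1 h2
  · exact Or.inl (hP0 ▸ hmem 0 (Nat.zero_le d))
  · exact Or.inr ⟨_, hmem _ (by omega), rfl⟩
  · exact Or.inl (hmem _ (by omega))

/-- The ratio of the diameter of a set and the radius of its largest ball. -/
def shapeRatio (K : Set (E d)) : ℝ :=
  Metric.diam K / sSup {r : ℝ | 0 ≤ r ∧ ∃ c : E d, Metric.closedBall c r ⊆ K}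

open scoped Pointwise in
theorem shapeRatio_homothety (K : Set (E d)) (c : E d) {s : ℝ} (hs : 0 < s) :
    shapeRatio ((fun x => c + s • x) '' K) = shapeRatio K := by
  have himg : (fun x => c + s • x) '' K = (fun x => c + x) '' (s • K) := by
    rw [← image_smul, image_image]
  have hdiam : Metric.diam ((fun x => c + s • x) '' K) = s * Metric.diam K := by
    rw [himg, (isometry_add_left c).diam_image, diam_smul₀, Real.norm_of_nonneg hs.le]
  have hball : ∀ (z : E d) (r : ℝ), 0 ≤ r → (fun x => c + s • x) '' Metric.closedBall z r =
      Metric.closedBall (c + s • z) (s * r) := by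
    intro z r hr
    have : (fun x => c + s • x) '' Metric.closedBall z r =
        (fun x => c + x) '' (s • Metric.closedBall z r) := by
      rw [← image_smul, image_image]
    rw [this, smul_closedBall _ _ hr, Real.norm_of_nonneg hs.le]
    simp [add_comm]
  have hinj : Function.Injective fun x : E d => c + s • x := fun x y hxy =>
    smul_right_injective (E d) hs.ne' (add_left_cancel hxy)
  have hset : {r : ℝ | 0 ≤ r ∧ ∃ z : E d, Metric.closedBall z r ⊆ (fun x => c + s • x) '' K} =
      s • {r : ℝ | 0 ≤ r ∧ ∃ z : E d, Metric.closedBall z r ⊆ K} := by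
    ext r
    rw [mem_smul_set_iff_inv_smul_mem₀ hs.ne', smul_eq_mul]
    have hr : s * (s⁻¹ * r) = r := mul_inv_cancel_left₀ hs.ne' r
    constructor
    · rintro ⟨hr0, z, hz⟩
      refine ⟨by positivity, s⁻¹ • (z - c), ?_⟩
      rw [← image_subset_image_iff hinj, hball _ _ (by positivity), hr, smul_inv_smul₀ hs.ne',
        add_sub_cancel]
      exact hz
    · rintro ⟨hr0, z, hz⟩
      have hr0' : 0 ≤ r := by rw [← hr]; positivity
      refine ⟨hr0', c + s • z, ?_⟩
      have := image_mono (f := fun x => c + s • x) hz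
      rwa [hball _ _ hr0, hr] at this
  rw [shapeRatio, shapeRatio, hdiam, hset, Real.sSup_smul_of_nonneg hs.le, smul_eq_mul,
    mul_div_mul_left _ _ hs.ne']

/-- Edge vectors of all reference paths stay in the finite set `B` built from the initial mesh, so
only finitely many reference simplices occur, and the shape ratio is invariant under homotheties. -/
theorem shapeConst_lt_top [NeZero d] (Ω : Set (E d)) (𝒯₀ : Mesh d) : shapeConst Ω 𝒯₀ < ⊤ := by
  have hY : (⋃ T ∈ 𝒯₀, range T.simplex.points).Finite :=
    𝒯₀.finite_toSet.biUnion fun T _ => finite_range _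
  set Y := ⋃ T ∈ 𝒯₀, range T.simplex.points
  set B₀ : Set (E d) := image2 (fun x y => x - y) Y Y
  have hB₀ : B₀.Finite := hY.image2 _ hY
  set B₁ : Set (E d) := B₀ ∪ ((fun x => (2 : ℝ) • x) '' B₀ ∪
    image2 (fun x y => (2 : ℝ) • x - y) B₀ B₀)
  have hB₁ : B₁.Finite := hB₀.union ((hB₀.image _).union (hB₀.image2 _ hB₀))
  set B := B₁ ∪ Neg.neg '' B₁
  have hB : B.Finite := hB₁.union (hB₁.image _)
  have hBneg : ∀ b ∈ B, -b ∈ B := by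
    rintro b (hb | ⟨b, hb, rfl⟩)
    · exact Or.inr ⟨b, hb, rfl⟩
    · exact Or.inl (by rwa [neg_neg])
  obtain ⟨G, hG, hGmem⟩ := exists_finite_refVertex (d := d) hB
  -- Degenerate vertex families are included; by finiteness the real-valued ratio is bounded on them
  -- as well.
  have hfin : {w : Fin (d + 1) → E d | ∀ i, w i ∈ G}.Finite := Set.Finite.pi' fun _ => hG
  obtain ⟨K, hK⟩ := (hfin.image fun w => shapeRatio (convexHull ℝ (range w))).bddAbove
  have hbound : ∀ 𝒯 ∈ meshFamily Ω 𝒯₀, ∀ T ∈ 𝒯, Metric.diam T.carrier / T.inradius ≤ K := by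
    intro 𝒯 h𝒯 T hT
    have h0 : ∀ T ∈ 𝒯₀, HasRefShape B T.tag T.vertex := by
      intro T hT
      have hY' : ∀ i, T.vertex i ∈ Y := fun i => mem_iUnion₂.2 ⟨T, hT, mem_range_self _⟩
      have hY₀ : ∀ i j, T.vertex i - T.vertex j ∈ B₀ := fun i j => ⟨_, hY' i, _, hY' j, rfl⟩
      refine hasRefShape_of_forall T.tag.2 fun i _ j _ => ⟨?_, ?_, ?_⟩
      · exact Or.inl (Or.inl (hY₀ i j))
      · exact Or.inl (Or.inr (Or.inl ⟨_, hY₀ i j, rfl⟩))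
      · exact Or.inl (Or.inr (Or.inr ⟨_, hY₀ i 0, _, hY₀ j 0, rfl⟩))
    obtain ⟨s, c, P, hs, hP0, hP, hv⟩ :=
      forall_mem_of_reflTransGen (p := fun T => HasRefShape B T.tag T.vertex) h𝒯.1 h0
        (fun T T₁ T₂ h hT => h.hasRefShape hBneg hT) T hT
    set w : Fin (d + 1) → E d := fun i => refVertex d T.tag P i
    have hw : ∀ i, w i ∈ G := fun i => hGmem P hP0 hP _ T.tag.2 i (Nat.lt_succ_iff.1 i.2)
    have hcar : T.carrier = (fun x => c + s • x) '' convexHull ℝ (range w) := by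
      have h1 : T.simplex.points = (fun x => c + s • x) ∘ w := by
        funext i
        rw [← T.vertex_eq i, hv i (Nat.lt_succ_iff.1 i.2)]
        rfl
      have h2 : (fun x : E d => c + s • x) =
          ⇑(AffineMap.const ℝ (E d) c + s • AffineMap.id ℝ (E d)) := by
        funext x
        simp
      rw [TaggedSimplex.carrier, h1, range_comp, h2, AffineMap.image_convexHull]
    have := hK ⟨w, hw, rfl⟩
    simp only at this
    rw [← shapeRatio_homothety _ c hs, ← hcar] at this
    exact this
  refine (iSup₂_le fun 𝒯 h𝒯 => iSup₂_le fun T hT => ?_ : shapeConst Ω 𝒯₀ ≤ ENNReal.ofReal K).trans_lt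
    ENNReal.ofReal_lt_top
  exact ENNReal.ofReal_le_ofReal (hbound 𝒯 h𝒯 T hT)

theorem diam_le_shapeConst_mul [NeZero d] (hd : 2 ≤ d) {Ω : Set (E d)} {𝒯₀ 𝒯 : Mesh d}
    (h𝒯 : 𝒯 ∈ meshFamily Ω 𝒯₀) {T : TaggedSimplex d} (hT : T ∈ 𝒯) :
    Metric.diam T.carrier ≤ (shapeConst Ω 𝒯₀).toReal * T.inradius := by
  have h1 : ENNReal.ofReal (Metric.diam T.carrier / T.inradius) ≤ shapeConst Ω 𝒯₀ :=
    le_iSup₂_of_le 𝒯 h𝒯 (le_iSup₂_of_le T hT le_rfl)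
  have h2 := (ENNReal.ofReal_le_iff_le_toReal (shapeConst_lt_top Ω 𝒯₀).ne).1 h1
  rwa [div_le_iff₀ (T.inradius_pos hd)] at h2

end Bisection

/-! ### Quasi-optimality of the total error -/

section TotalError

variable {d : ℕ} [NeZero d] {Ω : Set (E d)} {α : E d → ℝ → ℝ} {ca Ca Λ : ℝ} {𝒯 : Mesh d}

/-- The error contributes `(Ca/ca)²`, the oscillation of `V` the factor `2`, and the residual
difference `2K(1 + Ca/ca)²` through the triangle inequality for `U - V`. -/
theorem totalErrorSq_le {A : Lp (E d) 2 (vol Ω) → Lp (E d) 2 (vol Ω)}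
    (hA : ∀ u v : L2Pair Ω, form Ω α u u v = ⟪A u.2, v.2⟫)
    (hl : ∀ p q, ‖A p - A q‖ ≤ Ca * ‖p - q‖)
    (hm : ∀ p q, ca * ‖p - q‖ ^ 2 ≤ ⟪A p - A q, p - q⟫)
    (hα : IsAdmissibleCoeff Ω α ca Ca) (hca : 0 < ca) (hCa : 0 < Ca)
    (hΛ : IsPiecewiseLipschitz 𝒯 α Λ) (hΛ0 : 0 ≤ Λ) (hTΩ : ∀ T ∈ 𝒯, interior T.carrier ⊆ Ω)
    (hS : ∀ (T : TaggedSimplex d) (i : Fin (d + 1)), μHE[d - 1] (T.side i) < ⊤)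
    {f : Lp ℝ 2 (vol Ω)} {K : ℝ} (hK0 : 0 ≤ K) (hK : ∀ V ∈ feSpace Ω 𝒯, ∀ W ∈ feSpace Ω 𝒯,
      ∑ T ∈ 𝒯, residualDiff Ω α f 𝒯 V W T ^ 2 ≤ K * ‖(V - W).2‖ ^ 2)
    {u U V : L2Pair Ω} (hu : IsWeakSolution Ω α f u) (hU : IsDiscreteSolution Ω α f 𝒯 U)
    (hV : V ∈ feSpace Ω 𝒯) :
    totalErrorSq Ω α f 𝒯 u U ≤
      (2 + (Ca / ca) ^ 2 + 2 * K * (1 + Ca / ca) ^ 2) * totalErrorSq Ω α f 𝒯 u V := by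
  have h1 := galerkin_estimate hA hl hm hca hu hU hV
  have h2 := oscSq_le hα hΛ hΛ0 hTΩ hS f U V
  have h3 := hK U hU.1 V hV
  have h4 := oscSq_nonneg (𝒯 := 𝒯) (α := α) f V
  have h5 : ‖(U - V).2‖ ≤ (1 + Ca / ca) * ‖(V - u).2‖ := by
    have e : (U - V).2 = (U - u).2 - (V - u).2 := by
      simp only [Prod.snd_sub]
      abel
    rw [e]
    refine (norm_sub_le _ _).trans ?_
    linarith
  have h6 : ‖(U - u).2‖ ^ 2 ≤ (Ca / ca) ^ 2 * ‖(V - u).2‖ ^ 2 := by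
    rw [← mul_pow]
    gcongr
  have h7 : ‖(U - V).2‖ ^ 2 ≤ (1 + Ca / ca) ^ 2 * ‖(V - u).2‖ ^ 2 := by
    rw [← mul_pow]
    gcongr
  have h8 := mul_le_mul_of_nonneg_left h7 hK0
  have h9 : 0 ≤ ((Ca / ca) ^ 2 + 2 * K * (1 + Ca / ca) ^ 2) * oscSq Ω α f 𝒯 V := by positivity
  have h10 : 0 ≤ 2 * ‖(V - u).2‖ ^ 2 := by positivity
  rw [totalErrorSq, totalErrorSq]
  linarith

end TotalError

end QuasilinearFEM

end

/-- Cea's Lemma for the total error. The function `CE` expresses that the constant depends only on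
the problem data and on the shape regularity constant of the mesh family. -/
theorem lemmaL (d : ℕ) [NeZero d] (hd : d = 2 ∨ d = 3)
    (Ω : Set (E d)) (hΩo : IsOpen Ω) (hΩb : Bornology.IsBounded Ω) (hΩc : IsConnected Ω)
    (hΩr : interior (closure Ω) = Ω)
    (α : E d → ℝ → ℝ) (ca Ca Λ : ℝ) (hca : 0 < ca) (hCa : 0 < Ca)
    (hα : IsAdmissibleCoeff Ω α ca Ca) :
    ∃ CE : ℝ≥0∞ → ℝ, (∀ κ, 1 < CE κ) ∧
      ∀ 𝒯₀ : Mesh d, IsConformingTriangulation Ω 𝒯₀ → IsPiecewiseLipschitz 𝒯₀ α Λ →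
        -- there are constants `c_A` and `C_A` as in the strong monotonicity and Lipschitz bounds
        (∃ cA CA : ℝ, 0 < cA ∧ 0 < CA ∧ IsMonotoneConst Ω α cA ∧ IsLipschitzConst Ω α CA) ∧
        -- the defining property of the constant `C_E`
        (∀ 𝒯 ∈ meshFamily Ω 𝒯₀, ∀ f : Lp ℝ 2 (vol Ω),
          ∀ V ∈ feSpace Ω 𝒯, ∀ W ∈ feSpace Ω 𝒯,
            ∑ T ∈ 𝒯, residualDiff Ω α f 𝒯 V W T ^ 2 ≤
              CE (shapeConst Ω 𝒯₀) * ‖(V - W).2‖ ^ 2) ∧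
        -- the quasi-optimality of the total error
        (∀ cA CA : ℝ, 0 < cA → 0 < CA → IsMonotoneConst Ω α cA → IsLipschitzConst Ω α CA →
          ∀ f : Lp ℝ 2 (vol Ω), ∀ u : L2Pair Ω, IsWeakSolution Ω α f u →
          ∀ 𝒯 ∈ meshFamily Ω 𝒯₀, ∀ U : L2Pair Ω, IsDiscreteSolution Ω α f 𝒯 U →
            totalErrorSq Ω α f 𝒯 u U ≤
              2 * CE (shapeConst Ω 𝒯₀) * CA / cA *
                ⨅ V : feSpace Ω 𝒯, totalErrorSq Ω α f 𝒯 u V) := by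
  have hd2 : 2 ≤ d := by omega
  obtain ⟨C, hC0, hC⟩ := exists_measure_side_le d
  have hS : ∀ (T : TaggedSimplex d) (i : Fin (d + 1)), μHE[d - 1] (T.side i) < ⊤ :=
    fun T i => (hC T i).trans_lt ENNReal.ofReal_lt_top
  obtain ⟨K, hK0, hK⟩ : ∃ K : ℝ≥0∞ → ℝ, (∀ κ, 0 ≤ K κ) ∧
      ∀ 𝒯₀ : Mesh d, IsPiecewiseLipschitz 𝒯₀ α Λ → ∀ 𝒯 ∈ meshFamily Ω 𝒯₀,
        ∀ f : Lp ℝ 2 (vol Ω), ∀ V ∈ feSpace Ω 𝒯, ∀ W ∈ feSpace Ω 𝒯,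
          ∑ T ∈ 𝒯, residualDiff Ω α f 𝒯 V W T ^ 2 ≤
            K (shapeConst Ω 𝒯₀) * ‖(V - W).2‖ ^ 2 := by
    -- The maximum with `1` makes the shape parameter positive for every `κ`, including `⊤`, whose
    -- real value is `0`.
    refine ⟨fun κ => residualConst Ω Ca |Λ| C (max κ.toReal 1), fun κ => ?_, fun 𝒯₀ hΛ 𝒯 h𝒯 f V hV W hW =>
      sum_residualDiff_sq_le (k := max (shapeConst Ω 𝒯₀).toReal 1) hd2 hΩb hΩr hα hca hCa.le
        (hΛ.of_mem_meshFamily h𝒯) (abs_nonneg Λ) (by positivity) (fun T hT => ?_) h𝒯.2 hC0 hC f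
        hV hW⟩
    · simp only [residualConst]
      positivity
    · exact (diam_le_shapeConst_mul hd2 h𝒯 hT).trans
        (mul_le_mul_of_nonneg_right (le_max_left _ _) (T.inradius_pos hd2).le)
  have hM : 0 < Ca / ca := div_pos hCa hca
  -- The factor of `totalErrorSq_le` for the fixed pair `ca`, `Ca`; it is thus independent of the
  -- pair `cA`, `CA` chosen later, and it also dominates `K κ`.
  refine ⟨fun κ => 2 + (Ca / ca) ^ 2 + 2 * K κ * (1 + Ca / ca) ^ 2, fun κ => ?_,
    fun 𝒯₀ h𝒯₀ hΛ => ?_⟩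
  · have := hK0 κ
    have : 0 ≤ (Ca / ca) ^ 2 + 2 * K κ * (1 + Ca / ca) ^ 2 := by positivity
    linarith
  obtain ⟨A, hA, hl, hm⟩ := exists_fluxMap h𝒯₀ hΩo hΩr hΛ hα hca
  refine ⟨⟨ca, Ca, hca, hCa, isMonotoneConst_of_fluxMap hA hm, isLipschitzConst_of_fluxMap hA hl⟩,
    fun 𝒯 h𝒯 f V hV W hW => (hK 𝒯₀ hΛ 𝒯 h𝒯 f V hV W hW).trans ?_,
    fun cA CA hcA hCA hmA hlA f u hu 𝒯 h𝒯 U hU => ?_⟩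
  · have h0 := hK0 (shapeConst Ω 𝒯₀)
    refine mul_le_mul_of_nonneg_right ?_ (sq_nonneg _)
    nlinarith [mul_nonneg h0 hM.le, mul_nonneg h0 (sq_nonneg (Ca / ca)), sq_nonneg (Ca / ca)]
  have h0 := hK0 (shapeConst Ω 𝒯₀)
  have hle : 1 ≤ CA / cA :=
    (one_le_div hcA).2 (monotoneConst_le_lipschitzConst hΩo hΩc.nonempty hmA hlA)
  have : Nonempty (feSpace Ω 𝒯) := ⟨⟨U, hU.1⟩⟩
  set c := 2 + (Ca / ca) ^ 2 + 2 * K (shapeConst Ω 𝒯₀) * (1 + Ca / ca) ^ 2 with hc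
  have hcpos : 0 < c := by positivity
  -- The arbitrary pair enters only here, through `1 ≤ CA / cA`.
  have hfac : c ≤ 2 * c * CA / cA := by
    rw [mul_div_assoc]
    nlinarith
  rw [← div_le_iff₀' (hcpos.trans_le hfac)]
  refine le_ciInf fun V => ?_
  rw [div_le_iff₀' (hcpos.trans_le hfac)]
  refine (totalErrorSq_le hA hl hm hα hca hCa (hΛ.of_mem_meshFamily h𝒯) (abs_nonneg Λ)
    (fun T hT => h𝒯.2.interior_subset hΩr hT) hS h0 (hK 𝒯₀ hΛ 𝒯 h𝒯 f) hu hU V.2).trans ?_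
  exact mul_le_mul_of_nonneg_right hfac (add_nonneg (sq_nonneg _) (oscSq_nonneg f V.1))
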